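/- **Theorem 3.2.** A pebbling move on a finite connected simple graph $G$ takes two pebbles off a vertex and places one pebble on an adjacent vertex. For a vertex $w$ of $G$ let $f(G,w)$ be the smallest number $k$ such that from every placement of $k$ pebbles on the vertices of $G$ one pebble can be moved to $w$ by a (possibly empty) sequence of pebbling moves, and let $f(G)=\max_{w\in V(G)} f(G,w)$. The middle graph $M(G)$ is obtained from $G$ by inserting a new vertex into each edge of $G$ and joining two new vertices by an edge whenever the corresponding edges of $G$ share a vertex; thus $V(G)\subseteq V(M(G))$. Let $C_k$ denote the cycle with $k$ vertices and $\times$ the Cartesian product of graphs. Let $n,m\ge 2$ be integers, and let $(u,v)$ be a vertex of $M(C_{2n})\times M(C_{2m})$ with $(u,v)\notin V(C_{2n})\times V(C_{2m})$; that is, $u$ is a new vertex of $M(C_{2n})$ or $v$ is a new vertex of $M(C_{2m})$. Then $$f\bigl(M(C_{2n})\times M(C_{2m}),(u,v)\bigr)\le f\bigl(M(C_{2n})\bigr)\,f\bigl(M(C_{2m})\bigr).$$ -/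

import Mathlib

namespace Pebbling

open SimpleGraph

/-- The middle graph of `G`. Its vertices are the vertices of `G` (`Sum.inl`) together with one new
vertex for each edge of `G` (`Sum.inr`). A new vertex is joined to the two ends of its edge, and two
new vertices are joined when their edges are distinct and share an end (adjacency in the line graph).
The old vertices are pairwise non-adjacent, since every edge of `G` has been subdivided. -/
def middleGraph {V : Type*} (G : SimpleGraph V) : SimpleGraph (V ⊕ G.edgeSet) where
  Adj
    | .inl _, .inl _ => False
    | .inl v, .inr e => v ∈ (e : Sym2 V)
    | .inr e, .inl v => v ∈ (e : Sym2 V)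
    | .inr e, .inr e' => G.lineGraph.Adj e e'
  symm := ⟨by
    rintro (v | e) (w | e') h
    · exact h
    · exact h
    · exact h
    · exact SimpleGraph.Adj.symm h⟩
  loopless := ⟨by
    rintro (v | e) h
    · exact h
    · exact G.lineGraph.irrefl h⟩

/-- The vertices of `G` inside its middle graph. -/
def originalVertices {V : Type*} (G : SimpleGraph V) : Set (V ⊕ G.edgeSet) :=
  Set.range Sum.inl

/-- `Move G p q`: the distribution `q` arises from `p` by one pebbling move, which takes two pebbles
off a vertex `a` and puts one on a neighbour `b` of `a`. -/
def Move {V : Type*} (G : SimpleGraph V) (p q : V → ℕ) : Prop :=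
  ∃ a b, G.Adj a b ∧ p a = q a + 2 ∧ q b = p b + 1 ∧ ∀ w, w ≠ a → w ≠ b → q w = p w

/-- `q` arises from `p` by a finite (possibly empty) sequence of pebbling moves. -/
def Reaches {V : Type*} (G : SimpleGraph V) : (V → ℕ) → (V → ℕ) → Prop :=
  Relation.ReflTransGen (Move G)

/-- From every placement of exactly `k` pebbles on `G`, one pebble can be moved to `v`. -/
def Suffices {V : Type*} [Fintype V] (G : SimpleGraph V) (v : V) (k : ℕ) : Prop :=
  ∀ p : V → ℕ, ∑ w, p w = k → ∃ q, Reaches G p q ∧ 1 ≤ q v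

/-- The pebbling number `f(G, v)` of the target vertex `v`: the smallest number of pebbles that
suffices. The minimum is attained when `G` is connected, see `suffices_pebblingNumberAt`. -/
noncomputable def pebblingNumberAt {V : Type*} [Fintype V] (G : SimpleGraph V) (v : V) : ℕ :=
  sInf {k | Suffices G v k}

/-- The pebbling number `f(G)`: the maximum of `f(G, v)` over all vertices `v`. -/
noncomputable def pebblingNumber {V : Type*} [Fintype V] (G : SimpleGraph V) : ℕ :=
  Finset.univ.sup (pebblingNumberAt G)

/-! ### The pebbling numbers above are genuine minima -/

theorem reaches_of_adj {V : Type*} (G : SimpleGraph V) {a b : V} (h : G.Adj a b) (k : ℕ) :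
    ∀ p : V → ℕ, 2 * k ≤ p a → ∃ q, Reaches G p q ∧ k ≤ q b := by
  classical
  suffices H : ∀ p : V → ℕ, 2 * k ≤ p a → ∃ q, Reaches G p q ∧ p b + k ≤ q b by
    intro p hp
    obtain ⟨q, h1, h2⟩ := H p hp
    exact ⟨q, h1, by omega⟩
  induction k with
  | zero => exact fun p _ => ⟨p, Relation.ReflTransGen.refl, le_rfl⟩
  | succ k ih =>
    intro p hp
    have hab : a ≠ b := h.ne
    let p' : V → ℕ := fun w => if w = a then p a - 2 else if w = b then p b + 1 else p w
    have ha : p' a = p a - 2 := by simp [p']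
    have hb : p' b = p b + 1 := by simp [p', hab.symm]
    obtain ⟨q, h1, h2⟩ := ih p' (by omega)
    refine ⟨q, Relation.ReflTransGen.head ⟨a, b, h, by omega, hb, ?_⟩ h1, by omega⟩
    intro w hwa hwb
    simp [p', hwa, hwb]

theorem reaches_of_walk {V : Type*} (G : SimpleGraph V) {a b : V} (W : G.Walk a b) :
    ∀ p : V → ℕ, 2 ^ W.length ≤ p a → ∃ q, Reaches G p q ∧ 1 ≤ q b := by
  induction W with
  | nil => exact fun p hp => ⟨p, Relation.ReflTransGen.refl, by simpa using hp⟩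
  | cons h W ih =>
    intro p hp
    obtain ⟨q, h1, h2⟩ := reaches_of_adj G h (2 ^ W.length) p (by
      rw [SimpleGraph.Walk.length_cons, pow_succ] at hp
      omega)
    obtain ⟨r, h3, h4⟩ := ih q h2
    exact ⟨r, Relation.ReflTransGen.trans h1 h3, h4⟩

theorem exists_suffices {V : Type*} [Fintype V] {G : SimpleGraph V} (hG : G.Connected) (v : V) :
    ∃ k, Suffices G v k := by
  classical
  let W : ∀ w, G.Walk w v := fun w => (hG.preconnected w v).some
  refine ⟨∑ w, 2 ^ (W w).length, fun p hp => ?_⟩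
  obtain ⟨w, -, hw⟩ := Finset.exists_le_of_sum_le (s := Finset.univ) ⟨v, Finset.mem_univ v⟩ hp.ge
  exact reaches_of_walk G (W w) p hw

/-- In a connected graph, `f(G, v)` pebbles do suffice for the target `v`. -/
theorem suffices_pebblingNumberAt {V : Type*} [Fintype V] {G : SimpleGraph V} (hG : G.Connected)
    (v : V) : Suffices G v (pebblingNumberAt G v) :=
  Nat.sInf_mem (exists_suffices hG v)

theorem middleGraph_connected {V : Type*} {G : SimpleGraph V} (hG : G.Connected) :
    (middleGraph G).Connected := by
  have key : ∀ a b : V, (middleGraph G).Reachable (.inl a) (.inl b) := by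
    intro a b
    obtain ⟨W⟩ := hG.preconnected a b
    induction W with
    | nil => exact SimpleGraph.Reachable.refl _
    | @cons a c b h W ih =>
      have h1 : (middleGraph G).Adj (.inl a) (.inr ⟨s(a, c), h⟩) := Sym2.mem_mk_left a c
      have h2 : (middleGraph G).Adj (.inr ⟨s(a, c), h⟩) (.inl c) := Sym2.mem_mk_right a c
      exact h1.reachable.trans (h2.reachable.trans ih)
  have edge : ∀ x, ∃ a : V, (middleGraph G).Reachable x (.inl a) := by
    rintro (a | ⟨e, he⟩)
    · exact ⟨a, SimpleGraph.Reachable.refl _⟩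
    · induction e with
      | _ a c =>
        have h1 : (middleGraph G).Adj (.inr ⟨s(a, c), he⟩) (.inl a) := Sym2.mem_mk_left a c
        exact ⟨a, h1.reachable⟩
  obtain ⟨a⟩ := hG.nonempty
  have : Nonempty (V ⊕ G.edgeSet) := ⟨.inl a⟩
  refine ⟨fun x y => ?_⟩
  obtain ⟨b, hb⟩ := edge x
  obtain ⟨c, hc⟩ := edge y
  exact hb.trans ((key b c).trans hc.symm)

end Pebbling

/-! Both sides are compared with e(n) e(m), where e(n) = 2^(n+1) + 2n - 2 is `evenNumber n`.

Lower bound for the factors: put 2^(n+1) - 1 pebbles on the old vertex opposite an old target and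
one on every other old vertex except the target. Shortest routes run through new vertices, so an
isolated pebble on an old vertex is useless. A potential that weighs pebbles by 2^(-distance) and
counts only pairs on old vertices never grows under a move, and it starts below the value of one
pebble at the target (`not_suffices_of_potential`).

Upper bound for the product: a weight function that at least doubles along some edge towards the
target satisfies ∑ w p ≤ ∑ w for every distribution p that cannot reach the target. Two such
functions with sum at least 2 off the target bound the number of pebbles (`suffices_of_strategies`).
They come from the two ways round the second cycle, each ending at a neighbour (gate) of the target,
combined with a radial weight on the first cycle, whose target coordinate is a new vertex.

For n ≥ 3 the generic `gatedWeight` suffices, because 2n + 2 ≤ 2^n. On the 4-cycle this fails, and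
there every vertex of the middle graph is close to the target: `shortWeight` handles an old second
coordinate, and `centralWeight` handles two new coordinates on two 4-cycles. The remaining cases
follow by exchanging the factors. -/

namespace Pebbling

open SimpleGraph

/-! ### Moves and monotonicity in the number of pebbles -/

section General

variable {V V' : Type*}

theorem Move.add_right {G : SimpleGraph V} {p q : V → ℕ} (h : Move G p q) (r : V → ℕ) :
    Move G (p + r) (q + r) := by
  obtain ⟨a, b, hab, h1, h2, h3⟩ := h
  refine ⟨a, b, hab, ?_, ?_, fun w ha hb => ?_⟩
  · simp only [Pi.add_apply]; omega
  · simp only [Pi.add_apply]; omega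
  · simp only [Pi.add_apply, h3 w ha hb]

theorem Reaches.add_right {G : SimpleGraph V} {p q : V → ℕ} (h : Reaches G p q) (r : V → ℕ) :
    Reaches G (p + r) (q + r) := by
  induction h with
  | refl => exact Relation.ReflTransGen.refl
  | tail _ h ih => exact ih.tail (h.add_right r)

/-- One pebble is set aside and ignored. Since `Suffices` speaks of exactly `k` pebbles, this is
what makes the sufficient numbers upward closed, so that one insufficient number bounds the infimum
from below. -/
theorem Suffices.succ [Fintype V] {G : SimpleGraph V} {v : V} {k : ℕ} (h : Suffices G v k) :
    Suffices G v (k + 1) := by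
  classical
  intro p hp
  obtain ⟨a, -, ha⟩ : ∃ a ∈ Finset.univ, p a ≠ 0 := by
    apply Finset.exists_ne_zero_of_sum_ne_zero
    omega
  have hle : Pi.single a 1 ≤ p := by
    intro x
    by_cases hx : x = a
    · subst hx; simp; omega
    · simp [hx]
  have hsplit : (p - Pi.single a 1) + Pi.single a 1 = p := tsub_add_cancel_of_le hle
  have hsum : ∑ w, (p - Pi.single a 1 : V → ℕ) w = k := by
    have h1 : ∑ w, ((p - Pi.single a 1) + Pi.single a 1 : V → ℕ) w = k + 1 := by rw [hsplit, hp]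
    simp only [Pi.add_apply, Finset.sum_add_distrib, Finset.sum_pi_single', Finset.mem_univ,
      if_true] at h1
    omega
  obtain ⟨q, h1, h2⟩ := h _ hsum
  refine ⟨q + Pi.single a 1, ?_, ?_⟩
  · rw [← hsplit]; exact h1.add_right _
  · simp only [Pi.add_apply]; omega

theorem Suffices.mono [Fintype V] {G : SimpleGraph V} {v : V} {k l : ℕ} (h : Suffices G v k)
    (hkl : k ≤ l) : Suffices G v l := by
  induction hkl with
  | refl => exact h
  | step _ ih => exact ih.succ

theorem lt_pebblingNumberAt [Fintype V] {G : SimpleGraph V} (hG : G.Connected) {v : V} {k : ℕ}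
    (h : ¬ Suffices G v k) : k < pebblingNumberAt G v := by
  by_contra hlt
  exact h ((suffices_pebblingNumberAt hG v).mono (not_lt.mp hlt))

/-! ### Invariance under isomorphisms -/

theorem Move.map {G : SimpleGraph V} {G' : SimpleGraph V'} (e : G ≃g G') {p q : V → ℕ}
    (h : Move G p q) : Move G' (p ∘ e.symm) (q ∘ e.symm) := by
  obtain ⟨a, b, hab, h1, h2, h3⟩ := h
  refine ⟨e a, e b, e.map_adj_iff.mpr hab, by simpa using h1, by simpa using h2, ?_⟩
  intro w ha hb
  refine h3 _ ?_ ?_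
  · rintro rfl; simp at ha
  · rintro rfl; simp at hb

theorem Reaches.map {G : SimpleGraph V} {G' : SimpleGraph V'} (e : G ≃g G') {p q : V → ℕ}
    (h : Reaches G p q) : Reaches G' (p ∘ e.symm) (q ∘ e.symm) := by
  induction h with
  | refl => exact Relation.ReflTransGen.refl
  | tail _ h ih => exact ih.tail (h.map e)

theorem Suffices.map [Fintype V] [Fintype V'] {G : SimpleGraph V} {G' : SimpleGraph V'}
    (e : G ≃g G') {v : V} {k : ℕ} (h : Suffices G v k) : Suffices G' (e v) k := by
  intro p hp
  obtain ⟨q, h1, h2⟩ := h (p ∘ e) (by rw [← hp]; exact Equiv.sum_comp e.toEquiv p)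
  refine ⟨q ∘ e.symm, ?_, by simpa using h2⟩
  have h3 := h1.map e
  have h4 : (p ∘ e) ∘ e.symm = p := by ext; simp
  rwa [h4] at h3

/-- The isomorphism of box products induced by isomorphisms of the factors. -/
def boxProdIso {W W' : Type*} {G : SimpleGraph V} {G' : SimpleGraph V'} {H : SimpleGraph W}
    {H' : SimpleGraph W'} (e : G ≃g G') (f : H ≃g H') : (G □ H) ≃g (G' □ H') where
  toEquiv := Equiv.prodCongr e.toEquiv f.toEquiv
  map_rel_iff' := by
    rintro ⟨a, b⟩ ⟨c, d⟩
    simp [boxProd_adj, e.map_adj_iff, f.map_adj_iff]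

/-! ### Weight functions -/

/-- A weight function for the target `r`: it vanishes at `r`, and every vertex of positive weight
has a neighbour that is `r` or has at least twice its weight. -/
def IsStrategy (G : SimpleGraph V) (r : V) (w : V → ℕ) : Prop :=
  w r = 0 ∧ ∀ x, w x ≠ 0 → ∃ y, G.Adj x y ∧ (y = r ∨ 2 * w x ≤ w y)

/-- If the weighted sum exceeds the total weight, some vertex of positive weight holds two pebbles.
Moving them along its strategy edge reaches `r` or does not lower the weighted sum, while the number
of pebbles drops, so induction on that number ends at `r`. -/
theorem IsStrategy.exists_reaches [Fintype V] {G : SimpleGraph V} {r : V} {w : V → ℕ}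
    (hw : IsStrategy G r w) (k : ℕ) :
    ∀ p : V → ℕ, ∑ x, p x = k → ∑ x, w x < ∑ x, w x * p x →
      ∃ q, Reaches G p q ∧ 1 ≤ q r := by
  classical
  induction k with
  | zero =>
    intro p hp h
    have h0 : ∀ x, p x = 0 := by simpa using hp
    simp [h0] at h
  | succ k ih =>
    intro p hp h
    obtain ⟨x, -, hx⟩ := Finset.exists_lt_of_sum_lt h
    have hwx : w x ≠ 0 := by
      intro h0
      simp [h0] at hx
    have hpx : 2 ≤ p x := by
      by_contra hlt
      have : w x * p x ≤ w x * 1 := Nat.mul_le_mul_left _ (by omega)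
      omega
    obtain ⟨y, hxy, hy⟩ := hw.2 x hwx
    have hne : x ≠ y := hxy.ne
    let p' : V → ℕ := fun z => if z = x then p x - 2 else if z = y then p y + 1 else p z
    have hx' : p' x = p x - 2 := by simp [p']
    have hy' : p' y = p y + 1 := by simp [p', hne.symm]
    have hmove : Move G p p' := by
      refine ⟨x, y, hxy, by omega, hy', fun z h1 h2 => ?_⟩
      simp [p', h1, h2]
    rcases eq_or_ne y r with rfl | hyr
    · exact ⟨p', Relation.ReflTransGen.single hmove, by omega⟩
    have hy2 : 2 * w x ≤ w y := hy.resolve_left hyr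
    -- The move in additive form, free of truncated subtraction; summing it plainly and with weights
    -- gives the two balances below.
    have hpt : ∀ z, p z + (if z = y then 1 else 0) = p' z + 2 * (if z = x then 1 else 0) := by
      intro z
      rcases eq_or_ne z x with rfl | hzx
      · simp only [hx', hne, if_false, if_true]; omega
      · rcases eq_or_ne z y with rfl | hzy
        · simp only [hy', hzx, if_false, if_true]
        · simp [p', hzx, hzy]
    have hs : ∑ z, p z + 1 = ∑ z, p' z + 2 := by
      have := Finset.sum_congr (rfl : (Finset.univ : Finset V) = _) fun z _ => hpt z
      simpa [Finset.sum_add_distrib, ← Finset.mul_sum] using this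
    have hws : ∑ z, w z * p z + w y = ∑ z, w z * p' z + 2 * w x := by
      have := Finset.sum_congr (rfl : (Finset.univ : Finset V) = _)
        fun z _ => congrArg (w z * ·) (hpt z)
      simp only [mul_add, Finset.sum_add_distrib, mul_ite, mul_one, mul_zero, Finset.sum_ite_eq',
        Finset.mem_univ, if_true] at this
      omega
    obtain ⟨q, h1, h2⟩ := ih p' (by omega) (by omega)
    exact ⟨q, Relation.ReflTransGen.head hmove h1, h2⟩

/-- If `r` is out of reach, it carries no pebble and both weight inequalities hold; adding them
bounds `c * k` by the two total weights. -/
theorem suffices_of_strategies [Fintype V] {G : SimpleGraph V} {r : V} {w₁ w₂ : V → ℕ}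
    (h₁ : IsStrategy G r w₁) (h₂ : IsStrategy G r w₂) {c k : ℕ}
    (hc : ∀ x, x ≠ r → c ≤ w₁ x + w₂ x) (hk : ∑ x, w₁ x + ∑ x, w₂ x < c * k) :
    Suffices G r k := by
  intro p hp
  by_contra hcon
  have hr : p r = 0 := by
    by_contra h0
    exact hcon ⟨p, Relation.ReflTransGen.refl, by omega⟩
  have b₁ : ∑ x, w₁ x * p x ≤ ∑ x, w₁ x :=
    not_lt.mp fun h => hcon (h₁.exists_reaches k p hp h)
  have b₂ : ∑ x, w₂ x * p x ≤ ∑ x, w₂ x :=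
    not_lt.mp fun h => hcon (h₂.exists_reaches k p hp h)
  have hle : c * k ≤ ∑ x, w₁ x * p x + ∑ x, w₂ x * p x := by
    rw [← hp, Finset.mul_sum, ← Finset.sum_add_distrib]
    refine Finset.sum_le_sum fun x _ => ?_
    rcases eq_or_ne x r with rfl | hx
    · simp [hr]
    · rw [← add_mul]
      exact Nat.mul_le_mul_right _ (hc x hx)
  omega

end General

/-! ### Coordinates on the middle graph of a cycle -/

/-- `CycSucc i j`: `j` is the successor of `i` in the cyclic order of `Fin N`. -/
def CycSucc {N : ℕ} (i j : Fin N) : Prop :=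
  j.val = i.val + 1 ∨ (j.val = 0 ∧ i.val + 1 = N)

/-- The middle graph of the cycle of length `N` in coordinates: `Sum.inl i` is the `i`-th vertex of
the cycle, and `Sum.inr i` subdivides the edge from the `i`-th vertex to its successor. -/
def middleCycle (N : ℕ) (hN : 2 ≤ N) : SimpleGraph (Fin N ⊕ Fin N) where
  Adj
    | .inl _, .inl _ => False
    | .inl i, .inr j => i = j ∨ CycSucc j i
    | .inr j, .inl i => i = j ∨ CycSucc j i
    | .inr i, .inr j => CycSucc i j ∨ CycSucc j i
  symm := ⟨by
    rintro (i | i) (j | j) h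
    · exact h
    · exact h
    · exact h
    · exact Or.symm h⟩
  loopless := ⟨by
    rintro (i | i) h
    · exact h
    · rcases h with h | h <;> unfold CycSucc at h <;> omega⟩

theorem cycSucc_iff {k : ℕ} {i j : Fin (k + 3)} : CycSucc i j ↔ j = i + 1 := by
  unfold CycSucc
  rw [Fin.ext_iff, Fin.val_add_one]
  split_ifs with h
  · subst h; simp; omega
  · have : i.val ≠ k + 2 := fun h' => h (Fin.ext h')
    omega

/-- This is where length at least 3 enters: it keeps the edges `s(i, i + 1)` distinct. -/
theorem add_one_add_one_ne {k : ℕ} (i : Fin (k + 3)) : i + 1 + 1 ≠ i := by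
  intro h
  have h2 : (1 + 1 : Fin (k + 3)) = 0 := by
    rw [add_assoc] at h
    simpa using h
  have := congrArg Fin.val h2
  simp only [Fin.val_add, Fin.val_one, Fin.val_zero] at this
  rw [Nat.mod_eq_of_lt (by omega)] at this
  omega

theorem cycleGraph_adj_add_one {k : ℕ} (i : Fin (k + 3)) : (cycleGraph (k + 3)).Adj i (i + 1) := by
  rw [cycleGraph_adj]
  right
  simp

/-- The edge of the cycle from `i` to its successor. -/
def cycleEdge {k : ℕ} (i : Fin (k + 3)) : (cycleGraph (k + 3)).edgeSet :=
  ⟨s(i, i + 1), (mem_edgeSet _).mpr (cycleGraph_adj_add_one i)⟩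

/-- The vertex map of `middleCycle` into the middle graph of the cycle that starts at `a`. -/
def middleCycleMap {k : ℕ} (a : Fin (k + 3)) :
    Fin (k + 3) ⊕ Fin (k + 3) → Fin (k + 3) ⊕ (cycleGraph (k + 3)).edgeSet
  | .inl i => .inl (a + i)
  | .inr i => .inr (cycleEdge (a + i))

theorem cycleEdge_bijective {k : ℕ} : Function.Bijective (cycleEdge (k := k)) := by
  constructor
  · intro i j h
    have h : s(i, i + 1) = s(j, j + 1) := congrArg Subtype.val h
    rw [Sym2.eq_iff] at h
    rcases h with ⟨h, -⟩ | ⟨h, h'⟩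
    · exact h
    · rw [h] at h'
      exact absurd h' (add_one_add_one_ne j)
  · rintro ⟨e, he⟩
    induction e with
    | _ x y =>
      have hadj := he
      rw [mem_edgeSet, cycleGraph_adj] at hadj
      rcases hadj with h | h
      · refine ⟨y, Subtype.ext ?_⟩
        change s(y, y + 1) = s(x, y)
        rw [← h, add_sub_cancel, Sym2.eq_swap]
      · refine ⟨x, Subtype.ext ?_⟩
        change s(x, x + 1) = s(x, y)
        rw [← h, add_sub_cancel]

theorem middleCycleMap_bijective {k : ℕ} (a : Fin (k + 3)) :
    Function.Bijective (middleCycleMap a) := by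
  constructor
  · rintro (i | i) (j | j) h
    · simpa [middleCycleMap] using h
    · simp [middleCycleMap] at h
    · simp [middleCycleMap] at h
    · rw [add_left_cancel (cycleEdge_bijective.1 (Sum.inr.inj h))]
  · rintro (i | e)
    · exact ⟨.inl (i - a), by simp [middleCycleMap]⟩
    · obtain ⟨i, rfl⟩ := cycleEdge_bijective.2 e
      exact ⟨.inr (i - a), by simp [middleCycleMap]⟩

theorem lineGraph_adj_cycleEdge {k : ℕ} {i j : Fin (k + 3)} :
    (cycleGraph (k + 3)).lineGraph.Adj (cycleEdge i) (cycleEdge j) ↔ j = i + 1 ∨ i = j + 1 := by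
  rw [lineGraph_adj_iff_exists]
  constructor
  · rintro ⟨hne, x, hi, hj⟩
    simp only [cycleEdge, Sym2.mem_iff] at hi hj
    rcases hi with rfl | rfl <;> rcases hj with hj | hj
    · subst hj; exact absurd rfl hne
    · exact Or.inr hj
    · exact Or.inl hj.symm
    · have := add_right_cancel hj
      subst this; exact absurd rfl hne
  · intro h
    refine ⟨fun h' => ?_, ?_⟩
    · have h'' := cycleEdge_bijective.1 h'
      subst h''
      simp [eq_comm] at h
    · rcases h with rfl | rfl
      · exact ⟨i + 1, by simp [cycleEdge], by simp [cycleEdge]⟩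
      · exact ⟨j + 1, by simp [cycleEdge], by simp [cycleEdge]⟩

theorem middleCycleMap_adj {k : ℕ} (a : Fin (k + 3)) (x y : Fin (k + 3) ⊕ Fin (k + 3)) :
    (middleGraph (cycleGraph (k + 3))).Adj (middleCycleMap a x) (middleCycleMap a y) ↔
      (middleCycle (k + 3) (by omega)).Adj x y := by
  have key : ∀ i j : Fin (k + 3), a + i ∈ s(a + j, a + j + 1) ↔ i = j ∨ CycSucc j i := by
    intro i j
    rw [Sym2.mem_iff, cycSucc_iff, add_assoc]
    simp
  rcases x with i | i <;> rcases y with j | j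
  · exact Iff.rfl
  · exact key i j
  · exact key j i
  · refine lineGraph_adj_cycleEdge.trans ?_
    change _ ↔ CycSucc i j ∨ CycSucc j i
    rw [cycSucc_iff, cycSucc_iff, add_assoc, add_assoc]
    simp

/-- The coordinates on the middle graph of a cycle that start at the vertex `a`. -/
noncomputable def middleCycleIso {k : ℕ} (a : Fin (k + 3)) :
    middleCycle (k + 3) (by omega) ≃g middleGraph (cycleGraph (k + 3)) where
  toEquiv := Equiv.ofBijective _ (middleCycleMap_bijective a)
  map_rel_iff' := middleCycleMap_adj a _ _

theorem exists_iso_inl {N : ℕ} (hN : 3 ≤ N) (a : Fin N) :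
    ∃ e : middleCycle N (by omega) ≃g middleGraph (cycleGraph N),
      e (.inl ⟨0, by omega⟩) = .inl a := by
  obtain ⟨k, rfl⟩ : ∃ k, N = k + 3 := ⟨N - 3, by omega⟩
  refine ⟨middleCycleIso a, ?_⟩
  change Sum.inl (a + 0) = _
  rw [add_zero]

theorem exists_iso_inr {N : ℕ} (hN : 3 ≤ N) (x : (cycleGraph N).edgeSet) :
    ∃ e : middleCycle N (by omega) ≃g middleGraph (cycleGraph N),
      e (.inr ⟨0, by omega⟩) = .inr x := by
  obtain ⟨k, rfl⟩ : ∃ k, N = k + 3 := ⟨N - 3, by omega⟩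
  -- Coordinates starting at 0 locate the edge as some `i`; restarting them at `i` gives it the
  -- coordinate 0.
  obtain ⟨z, hz⟩ := (middleCycleMap_bijective (0 : Fin (k + 3))).2 (.inr x)
  rcases z with i | i
  · simp [middleCycleMap] at hz
  · refine ⟨middleCycleIso i, ?_⟩
    rw [← hz]
    change Sum.inr (cycleEdge (i + 0)) = Sum.inr (cycleEdge (0 + i))
    rw [add_zero, zero_add]

theorem middleGraph_cycleGraph_connected {N : ℕ} (hN : 3 ≤ N) :
    (middleGraph (cycleGraph N)).Connected := by
  obtain ⟨k, rfl⟩ : ∃ k, N = k + 1 := ⟨N - 1, by omega⟩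
  exact middleGraph_connected cycleGraph_connected

/-! ### The lower bound for the middle graph of an even cycle -/

section Potential

variable {V : Type*} [Fintype V]

open Classical in
/-- The potential of a distribution for the vertex values `c`, where on the vertices in `S` only
pairs of pebbles count. -/
noncomputable def potential (c : V → ℕ) (S : Set V) (p : V → ℕ) : ℕ :=
  ∑ x, c x * if x ∈ S then 2 * (p x / 2) else p x

/-- A move from `a` to `b` loses exactly `2 * c a`. At `b` it gains at most `c b` outside `S`, and
at most `2 * c b` inside `S`, where it may complete a pair; the two hypotheses bound these gains by
`2 * c a`. -/
theorem Move.potential_le {G : SimpleGraph V} {c : V → ℕ} {S : Set V}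
    (hc : ∀ x y, G.Adj x y → c y ≤ 2 * c x) (hS : ∀ x y, G.Adj x y → y ∈ S → c y ≤ c x)
    {p q : V → ℕ} (h : Move G p q) : potential c S q ≤ potential c S p := by
  classical
  obtain ⟨a, b, hab, h1, h2, h3⟩ := h
  have hne : a ≠ b := hab.ne
  have key : ∀ z, (c z * if z ∈ S then 2 * (q z / 2) else q z) + (if z = a then 2 * c a else 0) ≤
      (c z * if z ∈ S then 2 * (p z / 2) else p z) + (if z = b then 2 * c a else 0) := by
    intro z
    rcases eq_or_ne z a with rfl | hza
    · simp only [hne, if_true, if_false]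
      have : (if z ∈ S then 2 * (p z / 2) else p z) =
          (if z ∈ S then 2 * (q z / 2) else q z) + 2 := by
        split_ifs <;> omega
      rw [this, mul_add]
      omega
    · rcases eq_or_ne z b with rfl | hzb
      · simp only [hza, if_true, if_false]
        split_ifs with hz
        · have h4 : 2 * (q z / 2) ≤ 2 * (p z / 2) + 2 := by omega
          have h5 := Nat.mul_le_mul_left (c z) h4
          have h6 := hS a z hab hz
          rw [mul_add] at h5
          omega
        · have h6 := hc a z hab
          rw [h2, mul_add]
          omega
      · simp only [hza, hzb, if_false, h3 z hza hzb, le_refl]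
  have := Finset.sum_le_sum fun z (_ : z ∈ Finset.univ) => key z
  simp only [Finset.sum_add_distrib, Finset.sum_ite_eq', Finset.mem_univ, if_true] at this
  unfold potential
  convert Nat.le_of_add_le_add_right this

theorem not_suffices_of_potential {G : SimpleGraph V} {c : V → ℕ} {S : Set V}
    (hc : ∀ x y, G.Adj x y → c y ≤ 2 * c x) (hS : ∀ x y, G.Adj x y → y ∈ S → c y ≤ c x)
    {r : V} (hr : r ∉ S) {p : V → ℕ} (hp : potential c S p < c r) :
    ¬ Suffices G r (∑ x, p x) := by
  classical
  intro h
  obtain ⟨q, h1, h2⟩ := h p rfl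
  have hle : potential c S q ≤ potential c S p := by
    clear h2
    induction h1 with
    | refl => exact le_rfl
    | tail _ hm ih => exact (hm.potential_le hc hS).trans ih
  have hge : c r ≤ potential c S q := by
    unfold potential
    refine le_trans ?_ (Finset.single_le_sum (fun z _ => Nat.zero_le _) (Finset.mem_univ r))
    rw [if_neg hr]
    exact Nat.le_mul_of_pos_right _ h2
  omega

end Potential

/-- A lower bound for the pebbling number of the middle graph of the cycle of length `2 * n`. -/
def evenNumber (n : ℕ) : ℕ := 2 ^ (n + 1) + 2 * n - 2

/-- The distance to the vertex `Sum.inl 0` in `middleCycle (2 * n)`. -/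
def distInl (n : ℕ) : Fin (2 * n) ⊕ Fin (2 * n) → ℕ
  | .inl i => if i.val = 0 then 0 else min i.val (2 * n - i.val) + 1
  | .inr i => min (i.val + 1) (2 * n - i.val)

/-- A largest distribution on `middleCycle (2 * n)` from which `Sum.inl 0` is out of reach. -/
def extremalDistribution (n : ℕ) : Fin (2 * n) ⊕ Fin (2 * n) → ℕ
  | .inl i => if i.val = 0 then 0 else if i.val = n then 2 ^ (n + 1) - 1 else 1
  | .inr _ => 0

theorem sum_extremalDistribution {n : ℕ} (hn : 2 ≤ n) :
    ∑ x, extremalDistribution n x = evenNumber n - 1 := by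
  have hpos : 1 ≤ 2 ^ (n + 1) := Nat.one_le_two_pow
  have key : ∀ i : Fin (2 * n), extremalDistribution n (.inl i) +
      (if i = ⟨0, by omega⟩ then 1 else 0) + (if i = ⟨n, by omega⟩ then 1 else 0) =
      1 + (if i = ⟨n, by omega⟩ then 2 ^ (n + 1) - 1 else 0) := by
    intro i
    simp only [extremalDistribution, Fin.ext_iff]
    split_ifs <;> omega
  have hs := Finset.sum_congr (rfl : (Finset.univ : Finset (Fin (2 * n))) = _) fun i _ => key i
  simp only [Finset.sum_add_distrib, Finset.sum_ite_eq', Finset.mem_univ, if_true,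
    Finset.sum_const, Finset.card_univ, Fintype.card_fin, smul_eq_mul, mul_one] at hs
  rw [Fintype.sum_sum_type]
  simp only [extremalDistribution, Finset.sum_const_zero] at hs ⊢
  unfold evenNumber
  omega

theorem distInl_le_succ {n : ℕ} (hn : 2 ≤ n) {x y : Fin (2 * n) ⊕ Fin (2 * n)}
    (h : (middleCycle (2 * n) (by omega)).Adj x y) : distInl n x ≤ distInl n y + 1 := by
  rcases x with i | i <;> rcases y with j | j <;> simp only [middleCycle, CycSucc, Fin.ext_iff] at h
    <;> simp only [distInl] <;> (try split_ifs) <;> omega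

/-- No neighbour of an old vertex other than the target is farther from the target than that vertex,
so a move onto it makes no progress. This allows `S` to consist of these vertices. -/
theorem distInl_le_of_inl {n : ℕ} (hn : 2 ≤ n) {x : Fin (2 * n) ⊕ Fin (2 * n)} {j : Fin (2 * n)}
    (hj : j.val ≠ 0) (h : (middleCycle (2 * n) (by omega)).Adj x (.inl j)) :
    distInl n x ≤ distInl n (.inl j) := by
  rcases x with i | i <;> simp only [middleCycle, CycSucc, Fin.ext_iff] at h
  simp only [distInl, if_neg hj]
  omega

theorem not_suffices_middleCycle {n : ℕ} (hn : 2 ≤ n) :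
    ¬ Suffices (middleCycle (2 * n) (by omega)) (.inl ⟨0, by omega⟩) (evenNumber n - 1) := by
  rw [← sum_extremalDistribution hn]
  have hle : ∀ x, distInl n x ≤ n + 1 := by
    rintro (i | i) <;> simp only [distInl] <;> (try split_ifs) <;> omega
  refine not_suffices_of_potential (c := fun x => 2 ^ (n + 1 - distInl n x))
    (S := {x | ∃ j : Fin (2 * n), j.val ≠ 0 ∧ x = .inl j}) ?_ ?_ ?_ ?_
  · intro x y h
    have h1 := distInl_le_succ hn h
    have h2 := hle x
    rw [← pow_succ']
    exact Nat.pow_le_pow_right (by norm_num) (by omega)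
  · rintro x y h ⟨j, hj, rfl⟩
    exact Nat.pow_le_pow_right (by norm_num) (Nat.sub_le_sub_left (distInl_le_of_inl hn hj h) _)
  · rintro ⟨j, hj, h⟩
    exact hj (congrArg Fin.val (Sum.inl.inj h)).symm
  · have hpos : 1 ≤ 2 ^ (n + 1) := Nat.one_le_two_pow
    unfold potential
    -- Single pebbles in `S` count as zero. The odd pile at the opposite vertex, of value 1, counts
    -- as 2^(n+1) - 2, whereas the target has value 2^(n+1).
    rw [Finset.sum_eq_single (.inl ⟨n, by omega⟩)]
    · have h0 : n ≠ 0 := by omega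
      have h1 : n + 1 - distInl n (.inl ⟨n, by omega⟩) = 0 := by
        simp only [distInl, if_neg h0]
        omega
      beta_reduce
      rw [h1, if_pos ⟨⟨n, by omega⟩, h0, rfl⟩]
      simp only [distInl, extremalDistribution, if_neg h0, if_true, Nat.sub_zero]
      omega
    · rintro (i | i) - hi
      · have hin : i.val ≠ n := fun h => hi (congrArg Sum.inl (Fin.ext h))
        by_cases h0 : i.val = 0
        · simp [extremalDistribution, h0]
        · rw [if_pos ⟨i, h0, rfl⟩]
          simp [extremalDistribution, h0, hin]
      · simp [extremalDistribution]
    · simp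

theorem evenNumber_le_pebblingNumber {n : ℕ} (hn : 2 ≤ n) :
    evenNumber n ≤ pebblingNumber (middleGraph (cycleGraph (2 * n))) := by
  obtain ⟨e, -⟩ := exists_iso_inl (N := 2 * n) (by omega) ⟨0, by omega⟩
  have h := lt_pebblingNumberAt (middleGraph_cycleGraph_connected (N := 2 * n) (by omega))
    fun h => not_suffices_middleCycle hn (by simpa using h.map (v := e (.inl ⟨0, by omega⟩)) e.symm)
  refine le_trans ?_ (Finset.le_sup (Finset.mem_univ (e (.inl ⟨0, by omega⟩))))
  omega

/-! ### Weight functions on the factors -/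

section Weights

variable {α β : Type*}

/-- A positive weight function that doubles along an edge from every vertex other than `u`. -/
structure IsRadial (G : SimpleGraph α) (u : α) (φ : α → ℕ) : Prop where
  pos : ∀ x, 1 ≤ φ x
  step : ∀ x, x ≠ u → ∃ x', G.Adj x x' ∧ 2 * φ x ≤ φ x'

/-- A weight function for the target `v` all of whose pebbles pass through the neighbour `g`. -/
structure IsGated (H : SimpleGraph β) (v g : β) (ψ : β → ℕ) : Prop where
  target : ψ v = 0
  gate_pos : ψ g ≠ 0
  adj : H.Adj g v
  step : ∀ y, y ≠ g → ψ y ≠ 0 → ∃ y', H.Adj y y' ∧ 2 * ψ y ≤ ψ y'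

variable [DecidableEq α] [DecidableEq β]

/-- The weight function on the product for which pebbles first move in the second factor up to the
layer of the gate `g`, then in this layer according to `φ`. -/
def gatedWeight (u : α) (φ : α → ℕ) (v g : β) (ψ : β → ℕ) : α × β → ℕ := fun z =>
  if z.2 = v then if z.1 = u then 0 else φ z.1
  else if z.2 = g then φ z.1 * ψ g else ψ z.2

/-- Away from the layers of `v` and `g` only the second coordinate moves. Entering the gate layer
loses nothing because `φ` is at least 1; inside it `φ` leads to `(u, g)`, a neighbour of the target.
-/
theorem IsGated.isStrategy_gatedWeight {G : SimpleGraph α} {H : SimpleGraph β} {u : α} {v g : β}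
    {φ : α → ℕ} {ψ : β → ℕ} (hψ : IsGated H v g ψ) (hφ : IsRadial G u φ) :
    IsStrategy (G □ H) (u, v) (gatedWeight u φ v g ψ) := by
  have hgv : g ≠ v := hψ.adj.ne
  refine ⟨by simp [gatedWeight], ?_⟩
  rintro ⟨x, y⟩ hxy
  rcases eq_or_ne y v with rfl | hyv
  · have hxu : x ≠ u := by
      rintro rfl
      simp [gatedWeight] at hxy
    obtain ⟨x', h1, h2⟩ := hφ.step x hxu
    refine ⟨(x', y), by simp [boxProd_adj, h1], ?_⟩
    rcases eq_or_ne x' u with rfl | hx'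
    · exact Or.inl rfl
    · right
      simpa [gatedWeight, hxu, hx'] using h2
  rcases eq_or_ne y g with rfl | hyg
  · rcases eq_or_ne x u with rfl | hxu
    · exact ⟨(x, v), by simp [boxProd_adj, hψ.adj], Or.inl rfl⟩
    · obtain ⟨x', h1, h2⟩ := hφ.step x hxu
      refine ⟨(x', y), by simp [boxProd_adj, h1], Or.inr ?_⟩
      simp only [gatedWeight, hyv, if_false, if_true, ← mul_assoc]
      exact Nat.mul_le_mul_right _ h2
  · have hy : ψ y ≠ 0 := by simpa [gatedWeight, hyv, hyg] using hxy
    obtain ⟨y', h1, h2⟩ := hψ.step y hyg hy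
    have hy'v : y' ≠ v := by
      rintro rfl
      rw [hψ.target] at h2
      omega
    refine ⟨(x, y'), by simp [boxProd_adj, h1], Or.inr ?_⟩
    rcases eq_or_ne y' g with rfl | hy'g
    · simp only [gatedWeight, hyv, hyg, hy'v, if_false, if_true]
      exact h2.trans (Nat.le_mul_of_pos_left _ (hφ.pos x))
    · simpa only [gatedWeight, hyv, hyg, hy'v, hy'g, if_false] using h2

theorem le_gatedWeight {G : SimpleGraph α} {u : α} {v g : β} {φ : α → ℕ} {ψ : β → ℕ}
    (hφ : IsRadial G u φ) (x : α) {y : β} (hy : y ≠ v) : ψ y ≤ gatedWeight u φ v g ψ (x, y) := by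
  rcases eq_or_ne y g with rfl | hyg
  · simp only [gatedWeight, hy, if_false, if_true]
    exact Nat.le_mul_of_pos_left _ (hφ.pos x)
  · simp [gatedWeight, hy, hyg]

theorem IsGated.sum_gatedWeight [Fintype α] [Fintype β] {H : SimpleGraph β} {u : α} {v g : β}
    {φ : α → ℕ} {ψ : β → ℕ} (hψ : IsGated H v g ψ) :
    ∑ z, gatedWeight u φ v g ψ z + Fintype.card α * ψ g + φ u =
      Fintype.card α * ∑ y, ψ y + (∑ x, φ x) * ψ g + ∑ x, φ x := by
  have hgv : g ≠ v := hψ.adj.ne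
  have key : ∀ x y, gatedWeight u φ v g ψ (x, y) + (if y = g then ψ g else 0) +
      (if y = v then if x = u then φ u else 0 else 0) =
      ψ y + (if y = g then φ x * ψ g else 0) + (if y = v then φ x else 0) := by
    intro x y
    rcases eq_or_ne y v with rfl | hyv
    · rcases eq_or_ne x u with rfl | hxu
      · simp [gatedWeight, hψ.target, hgv.symm]
      · simp [gatedWeight, hψ.target, hgv.symm, hxu]
    · rcases eq_or_ne y g with rfl | hyg
      · simp [gatedWeight, hyv, add_comm]
      · simp [gatedWeight, hyv, hyg]
  have hs : ∑ x, ∑ y, _ = ∑ x, ∑ y, _ :=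
    Finset.sum_congr rfl fun x _ => Finset.sum_congr rfl fun y _ => key x y
  simp only [Finset.sum_add_distrib, Finset.sum_ite_eq', Finset.mem_univ, if_true,
    Finset.sum_const, Finset.card_univ, smul_eq_mul, ← Finset.sum_mul] at hs
  rw [Fintype.sum_prod_type]
  exact hs

theorem suffices_of_gated [Fintype α] [Fintype β] {G : SimpleGraph α} {H : SimpleGraph β}
    {u : α} {v g₁ g₂ : β} {φ : α → ℕ} {ψ₁ ψ₂ : β → ℕ} (hφ : IsRadial G u φ)
    (h₁ : IsGated H v g₁ ψ₁) (h₂ : IsGated H v g₂ ψ₂) (hcov : ∀ y, y ≠ v → 2 ≤ ψ₁ y + ψ₂ y)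
    {k : ℕ} (hk : ∑ z, gatedWeight u φ v g₁ ψ₁ z + ∑ z, gatedWeight u φ v g₂ ψ₂ z < 2 * k) :
    Suffices (G □ H) (u, v) k := by
  refine suffices_of_strategies (h₁.isStrategy_gatedWeight hφ) (h₂.isStrategy_gatedWeight hφ) ?_ hk
  rintro ⟨x, y⟩ hxy
  rcases eq_or_ne y v with rfl | hyv
  · have hxu : x ≠ u := by
      rintro rfl
      exact hxy rfl
    have := hφ.pos x
    simp only [gatedWeight, hxu, if_true, if_false]
    omega
  · have := hcov y hyv
    have := le_gatedWeight (ψ := ψ₁) (g := g₁) (v := v) hφ x hyv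
    have := le_gatedWeight (ψ := ψ₂) (g := g₂) (v := v) hφ x hyv
    omega

end Weights

/-! ### Short radial weights -/

section Short

variable {α β : Type*}

/-- A radial weight function with values `4` at `u`, `2` on some neighbours of `u`, and `1` on the
other vertices, each of which is adjacent to a vertex of weight `2`. -/
structure IsShort (G : SimpleGraph α) (u : α) (φ : α → ℕ) : Prop where
  center : φ u = 4
  values : ∀ x, x ≠ u → φ x = 1 ∨ φ x = 2
  adj : ∀ x, φ x = 2 → G.Adj x u
  step : ∀ x, φ x ≠ 2 → ∃ x', G.Adj x x' ∧ φ x' = 2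

theorem IsShort.ne {G : SimpleGraph α} {u : α} {φ : α → ℕ} (h : IsShort G u φ) {x : α}
    (hx : φ x = 2) : x ≠ u := by
  rintro rfl
  rw [h.center] at hx
  omega

theorem IsShort.isRadial {G : SimpleGraph α} {u : α} {φ : α → ℕ} (h : IsShort G u φ) :
    IsRadial G u φ := by
  constructor
  · intro x
    rcases eq_or_ne x u with rfl | hx
    · rw [h.center]; omega
    · have := h.values x hx
      omega
  · intro x hx
    rcases h.values x hx with h1 | h1
    · obtain ⟨x', h2, h3⟩ := h.step x (by omega)
      exact ⟨x', h2, by omega⟩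
    · exact ⟨u, h.adj x h1, by rw [h.center]; omega⟩

/-- The weight function on the product of two graphs with short radial weights for which pebbles
move to a vertex of weight `2` in both factors and then enter the layer of the first center. -/
def centralWeight (φ : α → ℕ) (χ : β → ℕ) : α × β → ℕ := fun z =>
  if χ z.2 = 4 then 0
  else if φ z.1 = 4 then if χ z.2 = 2 then 8 else 2
  else if φ z.1 = 2 then if χ z.2 = 2 then 4 else 2
  else 1

/-- The route is 1, 2, 4, 8: from the outer columns to a column with `φ = 2`, then to a layer with
`χ = 2`, then to the column of `u`, then to the target. The layer of `v` has weight 0 here and is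
covered by the version with exchanged factors. -/
theorem IsShort.isStrategy_centralWeight {G : SimpleGraph α} {H : SimpleGraph β} {u : α} {v : β}
    {φ : α → ℕ} {χ : β → ℕ} (hφ : IsShort G u φ) (hχ : IsShort H v χ) :
    IsStrategy (G □ H) (u, v) (centralWeight φ χ) := by
  refine ⟨by simp [centralWeight, hχ.center], ?_⟩
  rintro ⟨x, y⟩ hxy
  have hyv : y ≠ v := by
    rintro rfl
    simp [centralWeight, hχ.center] at hxy
  rcases eq_or_ne x u with rfl | hxu
  · rcases hχ.values y hyv with hy | hy
    · obtain ⟨y', h1, h2⟩ := hχ.step y (by omega)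
      refine ⟨(x, y'), by simp [boxProd_adj, h1], Or.inr ?_⟩
      simp [centralWeight, hy, h2, hφ.center]
    · exact ⟨(x, v), by simp [boxProd_adj, hχ.adj y hy], Or.inl rfl⟩
  · rcases hφ.values x hxu with hx | hx
    · obtain ⟨x', h1, h2⟩ := hφ.step x (by omega)
      refine ⟨(x', y), by simp [boxProd_adj, h1], Or.inr ?_⟩
      rcases hχ.values y hyv with hy | hy <;> simp [centralWeight, hx, hy, h2]
    · rcases hχ.values y hyv with hy | hy
      · obtain ⟨y', h1, h2⟩ := hχ.step y (by omega)
        refine ⟨(x, y'), by simp [boxProd_adj, h1], Or.inr ?_⟩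
        simp [centralWeight, hx, hy, h2]
      · refine ⟨(u, y), by simp [boxProd_adj, hφ.adj x hx], Or.inr ?_⟩
        simp [centralWeight, hx, hy, hφ.center]

variable [DecidableEq α] [DecidableEq β]

/-- The weight function on the product for which pebbles first move in the first factor to a vertex
`x` with `φ x = 2`, then in the second factor up to the gate `g`, then to the layer of `u`. Pebbles
at the far end `t` of the second factor first leave its layer. -/
def shortWeight (u : α) (φ : α → ℕ) (v g t : β) (ψ : β → ℕ) : α × β → ℕ := fun z =>
  if z.2 = v then if z.1 = u then 0 else φ z.1
  else if z.2 = g then if z.1 = u then 4 * ψ g else if φ z.1 = 2 then 2 * ψ g else 2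
  else if z.2 = t then 1
  else if φ z.1 = 2 then 2 * ψ z.2 else min 2 (ψ z.2)

/-- `t` is a vertex of weight `1`, and every other vertex has weight `0` or at least `2`. -/
structure IsFarEnd (g t : β) (ψ : β → ℕ) : Prop where
  eq_one : ψ t = 1
  ne_gate : t ≠ g
  two_le : ∀ y, y ≠ t → ψ y ≠ 0 → 2 ≤ ψ y

/-- Only the columns with `φ = 2` carry the doubling route along `ψ`, with factor 2. Outside them,
away from the layers of `v`, `g` and `t`, the capped weight `min 2 (ψ y)` is at most half of `2 * ψ
y`, so one step in the first factor enters the route. The cap is what saves total weight over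
`gatedWeight`. -/
theorem IsShort.isStrategy_shortWeight {G : SimpleGraph α} {H : SimpleGraph β} {u : α} {v g t : β}
    {φ : α → ℕ} {ψ : β → ℕ} (hφ : IsShort G u φ) (hψ : IsGated H v g ψ) (ht : IsFarEnd g t ψ) :
    IsStrategy (G □ H) (u, v) (shortWeight u φ v g t ψ) := by
  have hgv : g ≠ v := hψ.adj.ne
  have hg2 : 2 ≤ ψ g := ht.two_le g ht.ne_gate.symm hψ.gate_pos
  have htv : t ≠ v := by
    rintro rfl
    have := ht.eq_one
    rw [hψ.target] at this
    omega
  refine ⟨by simp [shortWeight], ?_⟩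
  rintro ⟨x, y⟩ hxy
  rcases eq_or_ne y v with rfl | hyv
  · have hxu : x ≠ u := by
      rintro rfl
      simp [shortWeight] at hxy
    obtain ⟨x', h1, h2⟩ := hφ.isRadial.step x hxu
    refine ⟨(x', y), by simp [boxProd_adj, h1], ?_⟩
    rcases eq_or_ne x' u with rfl | hx'
    · exact Or.inl rfl
    · right
      simpa [shortWeight, hxu, hx'] using h2
  rcases eq_or_ne y g with rfl | hyg
  · rcases eq_or_ne x u with rfl | hxu
    · exact ⟨(x, v), by simp [boxProd_adj, hψ.adj], Or.inl rfl⟩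
    · rcases eq_or_ne (φ x) 2 with hx | hx
      · refine ⟨(u, y), by simp [boxProd_adj, hφ.adj x hx], Or.inr ?_⟩
        simp only [shortWeight, hyv, hxu, hx, if_true, if_false]
        omega
      · obtain ⟨x', h1, h2⟩ := hφ.step x hx
        refine ⟨(x', y), by simp [boxProd_adj, h1], Or.inr ?_⟩
        simp only [shortWeight, hyv, hxu, hx, h2, hφ.ne h2, if_true, if_false]
        omega
  rcases eq_or_ne y t with rfl | hyt
  · obtain ⟨y', h1, h2⟩ := hψ.step y hyg (by rw [ht.eq_one]; omega)
    rw [ht.eq_one] at h2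
    have hy'v : y' ≠ v := by
      rintro rfl
      rw [hψ.target] at h2
      omega
    refine ⟨(x, y'), by simp [boxProd_adj, h1], Or.inr ?_⟩
    simp only [shortWeight, hyv, hyg, hy'v, h1.ne.symm, if_true, if_false]
    split_ifs <;> omega
  · have hy : ψ y ≠ 0 := by
      intro h0
      simp [shortWeight, hyv, hyg, hyt, h0] at hxy
    have hy2 := ht.two_le y hyt hy
    rcases eq_or_ne (φ x) 2 with hx | hx
    · obtain ⟨y', h1, h2⟩ := hψ.step y hyg hy
      have hy'v : y' ≠ v := by
        rintro rfl
        rw [hψ.target] at h2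
        omega
      have hy't : y' ≠ t := by
        rintro rfl
        rw [ht.eq_one] at h2
        omega
      refine ⟨(x, y'), by simp [boxProd_adj, h1], Or.inr ?_⟩
      rcases eq_or_ne y' g with rfl | hy'g
      · simp only [shortWeight, hyv, hyg, hyt, hy'v, hx, hφ.ne hx, if_true, if_false]
        omega
      · simp only [shortWeight, hyv, hyg, hyt, hy'v, hy'g, hy't, hx, if_true, if_false]
        omega
    · obtain ⟨x', h1, h2⟩ := hφ.step x hx
      refine ⟨(x', y), by simp [boxProd_adj, h1], Or.inr ?_⟩
      simp only [shortWeight, hyv, hyg, hyt, hx, h2, if_true, if_false]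
      omega

theorem IsGated.le_shortWeight {H : SimpleGraph β} {u : α} {v g t : β}
    {φ : α → ℕ} {ψ : β → ℕ} (hψ : IsGated H v g ψ) (ht : IsFarEnd g t ψ)
    (x : α) {y : β} (hy : y ≠ v) : min 2 (ψ y) ≤ shortWeight u φ v g t ψ (x, y) := by
  have hg2 : 2 ≤ ψ g := ht.two_le g ht.ne_gate.symm hψ.gate_pos
  have h1 := ht.eq_one
  simp only [shortWeight, hy, if_false]
  split_ifs with h2 <;> first | omega | (subst_vars; omega)

theorem IsShort.sum_shortWeight [Fintype α] [Fintype β] {G : SimpleGraph α} {H : SimpleGraph β}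
    {u : α} {v g t : β} {φ : α → ℕ} {ψ : β → ℕ} (hφ : IsShort G u φ) (hψ : IsGated H v g ψ)
    (ht : IsFarEnd g t ψ) (x : α) :
    ∑ y, shortWeight u φ v g t ψ (x, y) =
      if φ x = 4 then ∑ y, min 2 (ψ y) + 4 * ψ g - 2
      else if φ x = 2 then 2 * ∑ y, ψ y + 1 else ∑ y, min 2 (ψ y) + 1 := by
  have hgv : g ≠ v := hψ.adj.ne
  have hg2 : 2 ≤ ψ g := ht.two_le g ht.ne_gate.symm hψ.gate_pos
  have h1 := ht.eq_one
  have hv := hψ.target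
  have htv : t ≠ v := by
    rintro rfl
    omega
  have htg := ht.ne_gate
  rcases eq_or_ne x u with rfl | hxu
  · rw [if_pos hφ.center]
    have key : ∀ y, shortWeight x φ v g t ψ (x, y) + (if y = g then 2 else 0) =
        min 2 (ψ y) + (if y = g then 4 * ψ g else 0) := by
      intro y
      simp only [shortWeight, hφ.center, if_true]
      split_ifs with h2 h3 h4 h5 h6 <;> first | omega | (subst_vars; omega)
    have hs := Finset.sum_congr (rfl : (Finset.univ : Finset β) = _) fun y _ => key y
    simp only [Finset.sum_add_distrib, Finset.sum_ite_eq', Finset.mem_univ, if_true] at hs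
    omega
  · rcases hφ.values x hxu with hx | hx
    · rw [if_neg (by omega), if_neg (by omega)]
      have key : ∀ y, shortWeight u φ v g t ψ (x, y) =
          min 2 (ψ y) + (if y = v then 1 else 0) := by
        intro y
        simp only [shortWeight, hx, hxu, if_false]
        split_ifs with h2 h3 h4 h5 h6 <;> first | omega | (subst_vars; omega)
      have hs := Finset.sum_congr (rfl : (Finset.univ : Finset β) = _) fun y _ => key y
      simp only [Finset.sum_add_distrib, Finset.sum_ite_eq', Finset.mem_univ, if_true] at hs
      omega
    · rw [if_neg (by omega), if_pos hx]
      have key : ∀ y, shortWeight u φ v g t ψ (x, y) + (if y = t then 1 else 0) =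
          2 * ψ y + (if y = v then 2 else 0) := by
        intro y
        simp only [shortWeight, hx, hxu, if_false, if_true]
        split_ifs with h2 h3 h4 h5 h6 <;> first | omega | (subst_vars; omega)
      have hs := Finset.sum_congr (rfl : (Finset.univ : Finset β) = _) fun y _ => key y
      simp only [Finset.sum_add_distrib, Finset.sum_ite_eq', Finset.mem_univ, if_true,
        ← Finset.mul_sum] at hs
      omega

theorem suffices_of_short [Fintype α] [Fintype β] {G : SimpleGraph α} {H : SimpleGraph β}
    {u : α} {v g₁ g₂ t : β} {φ : α → ℕ} {ψ₁ ψ₂ : β → ℕ} (hφ : IsShort G u φ)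
    (h₁ : IsGated H v g₁ ψ₁) (h₂ : IsGated H v g₂ ψ₂) (ht₁ : IsFarEnd g₁ t ψ₁)
    (ht₂ : IsFarEnd g₂ t ψ₂) (hcov : ∀ y, y ≠ v → 2 ≤ ψ₁ y + ψ₂ y) {k : ℕ}
    (hk : ∑ z, shortWeight u φ v g₁ t ψ₁ z + ∑ z, shortWeight u φ v g₂ t ψ₂ z < 2 * k) :
    Suffices (G □ H) (u, v) k := by
  refine suffices_of_strategies (hφ.isStrategy_shortWeight h₁ ht₁)
    (hφ.isStrategy_shortWeight h₂ ht₂) ?_ hk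
  rintro ⟨x, y⟩ hxy
  rcases eq_or_ne y v with rfl | hyv
  · have hxu : x ≠ u := by
      rintro rfl
      exact hxy rfl
    have := hφ.isRadial.pos x
    simp only [shortWeight, hxu, if_true, if_false]
    omega
  · have := hcov y hyv
    have := h₁.le_shortWeight (u := u) (φ := φ) ht₁ x hyv
    have := h₂.le_shortWeight (u := u) (φ := φ) ht₂ x hyv
    omega

end Short

/-! ### Exchanging the factors and combining central weights -/

theorem IsStrategy.swap {α β : Type*} {G : SimpleGraph α} {H : SimpleGraph β} {u : α} {v : β}
    {w : β × α → ℕ} (h : IsStrategy (H □ G) (v, u) w) :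
    IsStrategy (G □ H) (u, v) (w ∘ Prod.swap) := by
  refine ⟨h.1, fun z hz => ?_⟩
  obtain ⟨y, h1, h2⟩ := h.2 z.swap hz
  refine ⟨y.swap, (boxProdComm G H).map_adj_iff.mp (by simpa using h1), ?_⟩
  rcases h2 with rfl | h2
  · exact Or.inl rfl
  · exact Or.inr (by simpa using h2)

theorem suffices_of_isShort {α β : Type*} [Fintype α] [Fintype β] {G : SimpleGraph α}
    {H : SimpleGraph β} {u : α} {v : β} {φ : α → ℕ} {χ : β → ℕ} (hφ : IsShort G u φ)
    (hχ : IsShort H v χ) {k : ℕ}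
    (hk : ∑ z, centralWeight φ χ z + ∑ z, centralWeight χ φ z < 2 * k) :
    Suffices (G □ H) (u, v) k := by
  refine suffices_of_strategies (hφ.isStrategy_centralWeight hχ)
    (hχ.isStrategy_centralWeight hφ).swap ?_ (c := 2) ?_
  · rintro ⟨x, y⟩ hxy
    rcases eq_or_ne x u with rfl | hxu
    · have hyv : y ≠ v := by
        rintro rfl
        exact hxy rfl
      rcases hχ.values y hyv with hy | hy <;> simp [centralWeight, hφ.center, hy]
    · rcases hφ.values x hxu with hx | hx
      · rcases eq_or_ne y v with rfl | hyv
        · simp [centralWeight, hχ.center, hx]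
        · rcases hχ.values y hyv with hy | hy <;> simp [centralWeight, hx, hy]
      · rcases eq_or_ne y v with rfl | hyv
        · simp [centralWeight, hχ.center, hx]
        · rcases hχ.values y hyv with hy | hy <;> simp [centralWeight, hx, hy]
  · have : ∑ z, (centralWeight χ φ ∘ Prod.swap) z = ∑ z, centralWeight χ φ z :=
      Equiv.sum_comp (Equiv.prodComm α β) (centralWeight χ φ)
    omega

/-! ### Weight functions on the middle graph of an even cycle -/

theorem two_mul_two_pow_le {a b : ℕ} (h : a + 1 ≤ b) : 2 * 2 ^ a ≤ 2 ^ b := by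
  rw [← pow_succ']
  exact Nat.pow_le_pow_right (by norm_num) h

theorem sum_two_pow (m : ℕ) : ∑ i ∈ Finset.range m, 2 ^ i + 1 = 2 ^ m := by
  induction m with
  | zero => rfl
  | succ m ih => rw [Finset.sum_range_succ, pow_succ]; omega

theorem sum_two_pow_sub (m : ℕ) : ∑ i ∈ Finset.range m, 2 ^ (m - i) + 2 = 2 ^ (m + 1) := by
  induction m with
  | zero => rfl
  | succ m ih =>
    rw [Finset.sum_range_succ', pow_succ]
    simp only [Nat.add_sub_add_right, Nat.sub_zero]
    omega

theorem sum_fin_two_mul (m : ℕ) (f : ℕ → ℕ) :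
    ∑ i : Fin (2 * m), f i = ∑ i ∈ Finset.range m, f i + ∑ i ∈ Finset.range m, f (m + i) := by
  rw [Fin.sum_univ_eq_sum_range, two_mul, Finset.sum_range_add]

/-- The weight function for the target `Sum.inr 0`. -/
def radialWeight (n : ℕ) : Fin (2 * n) ⊕ Fin (2 * n) → ℕ
  | .inl _ => 1
  | .inr i => 2 ^ (n - min i.val (2 * n - i.val))

theorem isRadial_radialWeight {n : ℕ} (hn : 2 ≤ n) :
    IsRadial (middleCycle (2 * n) (by omega)) (.inr ⟨0, by omega⟩) (radialWeight n) := by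
  constructor
  · rintro (i | i)
    · exact le_rfl
    · exact Nat.one_le_two_pow
  · rintro (i | i) hi
    · obtain ⟨j, hj, hle⟩ : ∃ j : Fin (2 * n), (i = j ∨ CycSucc j i) ∧
          0 + 1 ≤ n - min j.val (2 * n - j.val) := by
        by_cases h : 1 ≤ i.val ∧ i.val ≤ n
        · exact ⟨⟨i.val - 1, by omega⟩, Or.inr (Or.inl (by simp only; omega)), by simp only; omega⟩
        · exact ⟨i, Or.inl rfl, by omega⟩
      exact ⟨.inr j, hj, two_mul_two_pow_le hle⟩
    · have h0 : i.val ≠ 0 := fun h => hi (congrArg Sum.inr (Fin.ext h))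
      obtain ⟨j, hj, hle⟩ : ∃ j : Fin (2 * n), (CycSucc i j ∨ CycSucc j i) ∧
          n - min i.val (2 * n - i.val) + 1 ≤ n - min j.val (2 * n - j.val) := by
        unfold CycSucc
        by_cases h : i.val ≤ n
        · exact ⟨⟨i.val - 1, by omega⟩, by simp only; omega, by simp only; omega⟩
        · by_cases h' : i.val + 1 = 2 * n
          · exact ⟨⟨0, by omega⟩, Or.inl (Or.inr ⟨rfl, h'⟩), by simp only; omega⟩
          · exact ⟨⟨i.val + 1, by omega⟩, Or.inl (Or.inl rfl), by simp only; omega⟩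
      exact ⟨.inr j, hj, two_mul_two_pow_le hle⟩

theorem sum_radialWeight (n : ℕ) : ∑ x, radialWeight n x + 3 = 3 * 2 ^ n + 2 * n := by
  rw [Fintype.sum_sum_type]
  simp only [radialWeight, Finset.sum_const, Finset.card_univ, Fintype.card_fin, smul_eq_mul,
    mul_one]
  rw [sum_fin_two_mul n fun i => 2 ^ (n - min i (2 * n - i))]
  have h1 : ∑ i ∈ Finset.range n, 2 ^ (n - min i (2 * n - i)) =
      ∑ i ∈ Finset.range n, 2 ^ (n - i) := by
    refine Finset.sum_congr rfl fun i hi => ?_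
    have := Finset.mem_range.mp hi
    congr 1
    omega
  have h2 : ∑ i ∈ Finset.range n, 2 ^ (n - min (n + i) (2 * n - (n + i))) =
      ∑ i ∈ Finset.range n, 2 ^ i := by
    refine Finset.sum_congr rfl fun i hi => ?_
    have := Finset.mem_range.mp hi
    congr 1
    omega
  rw [h1, h2]
  have h3 := sum_two_pow n
  have h4 := sum_two_pow_sub n
  rw [pow_succ] at h4
  omega

/-- In the middle graph of the 4-cycle the target edge has weight 4, its two neighbouring edges 2,
and the opposite edge and the four old vertices 1. -/
theorem isShort_radialWeight :
    IsShort (middleCycle (2 * 2) (by omega)) (.inr ⟨0, by omega⟩) (radialWeight 2) := by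
  constructor
  · rfl
  · rintro (i | i) hi
    · exact Or.inl rfl
    · revert hi
      fin_cases i <;> simp [radialWeight]
  · rintro (i | i) hi
    · simp [radialWeight] at hi
    · revert hi
      fin_cases i <;> simp [radialWeight, middleCycle, CycSucc]
  · rintro (i | i) hi
    · by_cases h : i.val = 1 ∨ i.val = 2
      · refine ⟨.inr ⟨1, by omega⟩, ?_, rfl⟩
        simp only [middleCycle, CycSucc, Fin.ext_iff]
        omega
      · refine ⟨.inr ⟨3, by omega⟩, ?_, rfl⟩
        rcases (by omega : i.val = 0 ∨ i.val = 3) with h3 | h3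
        · exact Or.inr (Or.inr ⟨h3, rfl⟩)
        · exact Or.inl (Fin.ext h3)
    · refine ⟨.inr ⟨1, by omega⟩, ?_, rfl⟩
      revert hi
      fin_cases i <;> simp [radialWeight, middleCycle, CycSucc]

/-- The weight function for the target `Sum.inl 0` with gate `Sum.inr 0`. -/
def leftWeightInl (m : ℕ) : Fin (2 * m) ⊕ Fin (2 * m) → ℕ
  | .inl i => if i.val = 0 then 0 else if i.val < m then 2 else if i.val = m then 1 else 0
  | .inr i => if i.val < m then 2 ^ (m - i.val) else 0

/-- The weight function for the target `Sum.inl 0` with gate the last vertex `Sum.inr`. -/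
def rightWeightInl (m : ℕ) : Fin (2 * m) ⊕ Fin (2 * m) → ℕ
  | .inl i => if i.val < m then 0 else if i.val = m then 1 else 2
  | .inr i => if i.val < m then 0 else 2 ^ (i.val - m + 1)

/-- The weight function for the target `Sum.inr 0` with gate `Sum.inr 1`. -/
def leftWeightInr (m : ℕ) : Fin (2 * m) ⊕ Fin (2 * m) → ℕ
  | .inl i => if i.val = 0 then 0 else if i.val ≤ m then 2 else 0
  | .inr i => if i.val = 0 then 0 else if i.val ≤ m then 2 ^ (m - i.val + 1) else 0

/-- The weight function for the target `Sum.inr 0` with gate the last vertex `Sum.inr`. -/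
def rightWeightInr (m : ℕ) : Fin (2 * m) ⊕ Fin (2 * m) → ℕ
  | .inl i => if i.val = 0 then 2 else if i.val ≤ m then 0 else 2
  | .inr i => if i.val ≤ m then 0 else 2 ^ (i.val - m + 1)

theorem four_le_two_pow {a : ℕ} (h : 2 ≤ a) : 4 ≤ 2 ^ a :=
  Nat.pow_le_pow_right (n := 2) (by norm_num) h

theorem two_le_two_pow {a : ℕ} (h : 1 ≤ a) : 2 ≤ 2 ^ a :=
  Nat.pow_le_pow_right (n := 2) (by norm_num) h

/-! ### The two ways round the cycle as gated weights -/

theorem isGated_leftWeightInl {m : ℕ} (hm : 2 ≤ m) :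
    IsGated (middleCycle (2 * m) (by omega)) (.inl ⟨0, by omega⟩) (.inr ⟨0, by omega⟩)
      (leftWeightInl m) := by
  constructor
  · simp [leftWeightInl]
  · simp only [leftWeightInl]
    rw [if_pos (by omega)]
    positivity
  · exact Or.inl rfl
  · rintro (i | i) hi h0
    · simp only [leftWeightInl] at h0
      have hi0 : i.val ≠ 0 := fun h => h0 (by simp [h])
      have him : i.val ≤ m := by
        by_contra h
        exact h0 (by rw [if_neg hi0, if_neg (by omega), if_neg (by omega)])
      refine ⟨.inr ⟨i.val - 1, by omega⟩, Or.inr (Or.inl (by simp only; omega)), ?_⟩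
      simp only [leftWeightInl, if_neg hi0]
      rw [if_pos (c := i.val - 1 < m) (by omega)]
      split_ifs with h h
      · exact four_le_two_pow (by omega)
      · exact two_le_two_pow (by omega)
      · omega
    · have hi0 : i.val ≠ 0 := fun h => hi (congrArg Sum.inr (Fin.ext h))
      simp only [leftWeightInl] at h0
      have him : i.val < m := by
        by_contra h
        exact h0 (by rw [if_neg h])
      refine ⟨.inr ⟨i.val - 1, by omega⟩, Or.inr (Or.inl (by simp only; omega)), ?_⟩
      simp only [leftWeightInl]
      rw [if_pos him, if_pos (by omega)]
      exact two_mul_two_pow_le (by omega)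

theorem isGated_rightWeightInl {m : ℕ} (hm : 2 ≤ m) :
    IsGated (middleCycle (2 * m) (by omega)) (.inl ⟨0, by omega⟩) (.inr ⟨2 * m - 1, by omega⟩)
      (rightWeightInl m) := by
  constructor
  · simp only [rightWeightInl]
    rw [if_pos (by omega)]
  · simp only [rightWeightInl]
    rw [if_neg (by omega)]
    positivity
  · exact Or.inr (Or.inr ⟨rfl, by simp only; omega⟩)
  · rintro (i | i) hi h0
    · simp only [rightWeightInl] at h0
      have him : m ≤ i.val := by
        by_contra h
        exact h0 (by rw [if_pos (by omega)])
      refine ⟨.inr i, Or.inl rfl, ?_⟩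
      simp only [rightWeightInl]
      rw [if_neg (c := i.val < m) (by omega), if_neg (c := i.val < m) (by omega)]
      split_ifs with h
      · exact two_le_two_pow (by omega)
      · exact four_le_two_pow (by omega)
    · have hi0 : i.val ≠ 2 * m - 1 := fun h => hi (congrArg Sum.inr (Fin.ext h))
      simp only [rightWeightInl] at h0
      have him : m ≤ i.val := by
        by_contra h
        exact h0 (by rw [if_pos (by omega)])
      refine ⟨.inr ⟨i.val + 1, by omega⟩, Or.inl (Or.inl rfl), ?_⟩
      simp only [rightWeightInl]
      rw [if_neg (by omega), if_neg (by omega)]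
      exact two_mul_two_pow_le (by omega)

theorem isGated_leftWeightInr {m : ℕ} (hm : 2 ≤ m) :
    IsGated (middleCycle (2 * m) (by omega)) (.inr ⟨0, by omega⟩) (.inr ⟨1, by omega⟩)
      (leftWeightInr m) := by
  constructor
  · simp [leftWeightInr]
  · simp only [leftWeightInr]
    rw [if_neg (by omega), if_pos (by omega)]
    positivity
  · exact Or.inr (Or.inl rfl)
  · rintro (i | i) hi h0
    · simp only [leftWeightInr] at h0
      have hi0 : i.val ≠ 0 := fun h => h0 (by simp [h])
      have him : i.val ≤ m := by
        by_contra h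
        exact h0 (by rw [if_neg hi0, if_neg (by omega)])
      -- The preceding edge of old vertex 1 is the target itself, of weight 0, so this vertex goes
      -- straight to the gate.
      by_cases hi1 : i.val = 1
      · refine ⟨.inr i, Or.inl rfl, ?_⟩
        simp only [leftWeightInr]
        rw [if_neg hi0, if_pos him, if_neg hi0, if_pos him]
        exact four_le_two_pow (by omega)
      · refine ⟨.inr ⟨i.val - 1, by omega⟩, Or.inr (Or.inl (by simp only; omega)), ?_⟩
        simp only [leftWeightInr]
        rw [if_neg hi0, if_pos him, if_neg (by omega), if_pos (by omega)]
        exact four_le_two_pow (by omega)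
    · have hi1 : i.val ≠ 1 := fun h => hi (congrArg Sum.inr (Fin.ext h))
      simp only [leftWeightInr] at h0
      have hi0 : i.val ≠ 0 := fun h => h0 (by simp [h])
      have him : i.val ≤ m := by
        by_contra h
        exact h0 (by rw [if_neg hi0, if_neg h])
      refine ⟨.inr ⟨i.val - 1, by omega⟩, Or.inr (Or.inl (by simp only; omega)), ?_⟩
      simp only [leftWeightInr]
      rw [if_neg hi0, if_pos him, if_neg (by omega), if_pos (by omega)]
      exact two_mul_two_pow_le (by omega)

theorem isGated_rightWeightInr {m : ℕ} (hm : 2 ≤ m) :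
    IsGated (middleCycle (2 * m) (by omega)) (.inr ⟨0, by omega⟩) (.inr ⟨2 * m - 1, by omega⟩)
      (rightWeightInr m) := by
  constructor
  · simp [rightWeightInr]
  · simp only [rightWeightInr]
    rw [if_neg (by omega)]
    positivity
  · exact Or.inl (Or.inr ⟨rfl, by simp only; omega⟩)
  · rintro (i | i) hi h0
    · simp only [rightWeightInr] at h0
      -- Old vertex 0 is an end of the target edge; it joins this side through the last edge, across
      -- the wrap-around.
      by_cases hi0 : i.val = 0
      · refine ⟨.inr ⟨2 * m - 1, by omega⟩, Or.inr (Or.inr ⟨hi0, by simp only; omega⟩), ?_⟩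
        simp only [rightWeightInr]
        rw [if_pos hi0, if_neg (by omega)]
        exact four_le_two_pow (by omega)
      · have him : m < i.val := by
          by_contra h
          exact h0 (by rw [if_neg hi0, if_pos (by omega)])
        refine ⟨.inr i, Or.inl rfl, ?_⟩
        simp only [rightWeightInr]
        rw [if_neg hi0, if_neg (by omega), if_neg (by omega)]
        exact four_le_two_pow (by omega)
    · have hi0 : i.val ≠ 2 * m - 1 := fun h => hi (congrArg Sum.inr (Fin.ext h))
      simp only [rightWeightInr] at h0
      have him : m < i.val := by
        by_contra h
        exact h0 (by rw [if_pos (by omega)])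
      refine ⟨.inr ⟨i.val + 1, by omega⟩, Or.inl (Or.inl rfl), ?_⟩
      simp only [rightWeightInr]
      rw [if_neg (by omega), if_neg (by omega)]
      exact two_mul_two_pow_le (by omega)

/-! ### Covering by the two ways round, and the far end -/

theorem two_le_weightInl {m : ℕ} (hm : 2 ≤ m) (y : Fin (2 * m) ⊕ Fin (2 * m))
    (hy : y ≠ .inl ⟨0, by omega⟩) : 2 ≤ leftWeightInl m y + rightWeightInl m y := by
  rcases y with i | i
  · have hi0 : i.val ≠ 0 := fun h => hy (congrArg Sum.inl (Fin.ext h))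
    simp only [leftWeightInl, rightWeightInl]
    split_ifs <;> omega
  · simp only [leftWeightInl, rightWeightInl]
    by_cases h : i.val < m
    · rw [if_pos h, if_pos h]
      exact two_le_two_pow (by omega)
    · rw [if_neg h, if_neg h, zero_add]
      exact two_le_two_pow (by omega)

theorem two_le_weightInr {m : ℕ} (hm : 2 ≤ m) (y : Fin (2 * m) ⊕ Fin (2 * m))
    (hy : y ≠ .inr ⟨0, by omega⟩) : 2 ≤ leftWeightInr m y + rightWeightInr m y := by
  rcases y with i | i
  · simp only [leftWeightInr, rightWeightInr]
    split_ifs <;> omega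
  · have hi0 : i.val ≠ 0 := fun h => hy (congrArg Sum.inr (Fin.ext h))
    simp only [leftWeightInr, rightWeightInr]
    rw [if_neg hi0]
    by_cases h : i.val ≤ m
    · rw [if_pos h, if_pos h]
      exact two_le_two_pow (by omega)
    · rw [if_neg h, if_neg h, zero_add]
      exact two_le_two_pow (by omega)

theorem isFarEnd_leftWeightInl {m : ℕ} (hm : 2 ≤ m) :
    IsFarEnd (.inr ⟨0, by omega⟩) (.inl ⟨m, by omega⟩) (leftWeightInl m) := by
  constructor
  · simp only [leftWeightInl]
    rw [if_neg (by omega), if_neg (by omega), if_pos trivial]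
  · simp
  · rintro (i | i) hi h0
    · have him : i.val ≠ m := fun h => hi (congrArg Sum.inl (Fin.ext h))
      simp only [leftWeightInl] at h0 ⊢
      split_ifs at h0 ⊢ <;> omega
    · simp only [leftWeightInl] at h0 ⊢
      split_ifs at h0 ⊢
      · exact two_le_two_pow (by omega)
      · omega

theorem isFarEnd_rightWeightInl {m : ℕ} (hm : 2 ≤ m) :
    IsFarEnd (.inr ⟨2 * m - 1, by omega⟩) (.inl ⟨m, by omega⟩) (rightWeightInl m) := by
  constructor
  · simp only [rightWeightInl]
    rw [if_neg (by omega), if_pos trivial]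
  · simp
  · rintro (i | i) hi h0
    · have him : i.val ≠ m := fun h => hi (congrArg Sum.inl (Fin.ext h))
      simp only [rightWeightInl] at h0 ⊢
      split_ifs at h0 ⊢ <;> omega
    · simp only [rightWeightInl] at h0 ⊢
      split_ifs at h0 ⊢
      · omega
      · exact two_le_two_pow (by omega)

/-! ### Total weights on the second factor -/

theorem sum_sum_fin_two_mul (m : ℕ) (f g : ℕ → ℕ) (h : Fin (2 * m) ⊕ Fin (2 * m) → ℕ)
    (hf : ∀ i : Fin (2 * m), h (.inl i) = f i) (hg : ∀ i : Fin (2 * m), h (.inr i) = g i) :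
    ∑ y, h y = (∑ i ∈ Finset.range m, f i + ∑ i ∈ Finset.range m, f (m + i)) +
      (∑ i ∈ Finset.range m, g i + ∑ i ∈ Finset.range m, g (m + i)) := by
  rw [Fintype.sum_sum_type, ← sum_fin_two_mul, ← sum_fin_two_mul]
  simp only [hf, hg]

theorem sum_range_of_eq_const {m : ℕ} (hm : 1 ≤ m) {f : ℕ → ℕ} {c : ℕ}
    (h : ∀ i, 1 ≤ i → i < m → f i = c) : ∑ i ∈ Finset.range m, f i = f 0 + (m - 1) * c := by
  obtain ⟨k, rfl⟩ : ∃ k, m = k + 1 := ⟨m - 1, by omega⟩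
  rw [Finset.sum_range_succ', Finset.sum_congr rfl fun i hi =>
    h (i + 1) (by omega) (by have := Finset.mem_range.mp hi; omega)]
  simp [add_comm]

theorem sum_leftWeightInl {m : ℕ} (hm : 2 ≤ m) :
    ∑ y, leftWeightInl m y + 3 = 2 ^ (m + 1) + 2 * m := by
  rw [sum_sum_fin_two_mul m
    (fun i => if i = 0 then 0 else if i < m then 2 else if i = m then 1 else 0)
    (fun i => if i < m then 2 ^ (m - i) else 0) _ (fun _ => rfl) (fun _ => rfl)]
  rw [sum_range_of_eq_const (c := 2) (by omega) (fun i h1 h2 => by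
      rw [if_neg (by omega), if_pos h2]),
    sum_range_of_eq_const (c := 0) (by omega) (fun i h1 h2 => by
      rw [if_neg (by omega), if_neg (by omega), if_neg (by omega)]),
    Finset.sum_congr rfl fun i hi => if_pos (Finset.mem_range.mp hi),
    Finset.sum_congr rfl fun i hi => if_neg (by omega)]
  have := sum_two_pow_sub m
  simp only [add_zero, Finset.sum_const_zero, mul_zero, if_true, lt_irrefl, if_false]
  rw [if_neg (by omega)]
  omega

theorem sum_min_leftWeightInl {m : ℕ} (hm : 2 ≤ m) :
    ∑ y, min 2 (leftWeightInl m y) = 4 * m - 1 := by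
  rw [sum_sum_fin_two_mul m
    (fun i => min 2 (if i = 0 then 0 else if i < m then 2 else if i = m then 1 else 0))
    (fun i => min 2 (if i < m then 2 ^ (m - i) else 0)) _ (fun _ => rfl) (fun _ => rfl)]
  rw [sum_range_of_eq_const (c := 2) (by omega) (fun i h1 h2 => by
      rw [if_neg (by omega), if_pos h2, min_self]),
    sum_range_of_eq_const (c := 0) (by omega) (fun i h1 h2 => by
      rw [if_neg (by omega), if_neg (by omega), if_neg (by omega)]; rfl),
    sum_range_of_eq_const (c := 2) (by omega) (fun i h1 h2 => by
      rw [if_pos h2]; exact min_eq_left (two_le_two_pow (by omega))),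
    sum_range_of_eq_const (c := 0) (by omega) (fun i h1 h2 => by
      rw [if_neg (by omega)]; rfl)]
  have := two_le_two_pow (a := m) (by omega)
  simp only [add_zero, mul_zero, if_true, lt_irrefl, if_false, Nat.sub_zero]
  rw [if_neg (by omega), if_pos (by omega)]
  omega

theorem sum_rightWeightInl {m : ℕ} (hm : 2 ≤ m) :
    ∑ y, rightWeightInl m y + 3 = 2 ^ (m + 1) + 2 * m := by
  rw [sum_sum_fin_two_mul m (fun i => if i < m then 0 else if i = m then 1 else 2)
    (fun i => if i < m then 0 else 2 ^ (i - m + 1)) _ (fun _ => rfl) (fun _ => rfl)]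
  rw [sum_range_of_eq_const (c := 0) (by omega) (fun i h1 h2 => if_pos h2),
    sum_range_of_eq_const (c := 2) (by omega) (fun i h1 h2 => by
      rw [if_neg (by omega), if_neg (by omega)]),
    Finset.sum_congr rfl fun i hi => if_pos (Finset.mem_range.mp hi),
    Finset.sum_congr rfl fun i hi => (if_neg (by omega) : ite (m + i < m) _ _ = _)]
  have := sum_two_pow m
  simp only [add_zero, Finset.sum_const_zero, mul_zero, if_true, lt_irrefl, if_false,
    Nat.add_sub_cancel_left, pow_succ, ← Finset.sum_mul]
  rw [if_pos (by omega)]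
  omega

theorem sum_min_rightWeightInl {m : ℕ} (hm : 2 ≤ m) :
    ∑ y, min 2 (rightWeightInl m y) = 4 * m - 1 := by
  rw [sum_sum_fin_two_mul m (fun i => min 2 (if i < m then 0 else if i = m then 1 else 2))
    (fun i => min 2 (if i < m then 0 else 2 ^ (i - m + 1))) _ (fun _ => rfl) (fun _ => rfl)]
  rw [sum_range_of_eq_const (c := 0) (by omega) (fun i h1 h2 => by rw [if_pos h2]; rfl),
    sum_range_of_eq_const (c := 2) (by omega) (fun i h1 h2 => by
      rw [if_neg (by omega), if_neg (by omega), min_self]),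
    sum_range_of_eq_const (c := 0) (by omega) (fun i h1 h2 => by rw [if_pos h2]; rfl),
    sum_range_of_eq_const (c := 2) (by omega) (fun i h1 h2 => by
      rw [if_neg (by omega)]; exact min_eq_left (two_le_two_pow (by omega)))]
  simp only [add_zero, mul_zero, if_true, lt_irrefl, if_false, Nat.sub_self, zero_add, pow_one]
  rw [if_pos (by omega), if_pos (by omega)]
  omega

theorem sum_leftWeightInr {m : ℕ} (hm : 2 ≤ m) :
    ∑ y, leftWeightInr m y + 2 = 2 ^ (m + 1) + 2 * m := by
  rw [sum_sum_fin_two_mul m (fun i => if i = 0 then 0 else if i ≤ m then 2 else 0)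
    (fun i => if i = 0 then 0 else if i ≤ m then 2 ^ (m - i + 1) else 0) _
    (fun _ => rfl) (fun _ => rfl)]
  rw [sum_range_of_eq_const (c := 2) (by omega) (fun i h1 h2 => by
      rw [if_neg (by omega), if_pos (by omega)]),
    sum_range_of_eq_const (c := 0) (by omega) (fun i h1 h2 => by
      rw [if_neg (by omega), if_neg (by omega)]),
    sum_range_of_eq_const (c := 0) (f := fun i => if m + i = 0 then 0 else if m + i ≤ m then
      2 ^ (m - (m + i) + 1) else 0) (by omega) (fun i h1 h2 => by
      rw [if_neg (by omega), if_neg (by omega)])]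
  obtain ⟨k, rfl⟩ : ∃ k, m = k + 1 := ⟨m - 1, by omega⟩
  rw [Finset.sum_range_succ']
  have h1 : ∑ i ∈ Finset.range k, (if i + 1 = 0 then 0 else if i + 1 ≤ k + 1 then
      2 ^ (k + 1 - (i + 1) + 1) else 0) = ∑ i ∈ Finset.range k, 2 ^ (k - i) * 2 := by
    refine Finset.sum_congr rfl fun i hi => ?_
    have := Finset.mem_range.mp hi
    rw [if_neg (by omega), if_pos (by omega), Nat.add_sub_add_right, pow_succ]
  have h2 := sum_two_pow_sub k
  rw [h1, ← Finset.sum_mul]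
  simp only [add_zero, mul_zero, if_true, le_refl, Nat.sub_self, zero_add, pow_one]
  rw [if_neg (by omega), pow_succ _ (k + 1)]
  omega

theorem sum_rightWeightInr {m : ℕ} (hm : 2 ≤ m) :
    ∑ y, rightWeightInr m y + 4 = 2 ^ (m + 1) + 2 * m := by
  rw [sum_sum_fin_two_mul m (fun i => if i = 0 then 2 else if i ≤ m then 0 else 2)
    (fun i => if i ≤ m then 0 else 2 ^ (i - m + 1)) _ (fun _ => rfl) (fun _ => rfl)]
  rw [sum_range_of_eq_const (c := 0) (by omega) (fun i h1 h2 => by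
      rw [if_neg (by omega), if_pos (by omega)]),
    sum_range_of_eq_const (c := 2) (by omega) (fun i h1 h2 => by
      rw [if_neg (by omega), if_neg (by omega)]),
    sum_range_of_eq_const (c := 0) (f := fun i => if i ≤ m then 0 else 2 ^ (i - m + 1)) (by omega)
      (fun i h1 h2 => if_pos (by omega))]
  obtain ⟨k, rfl⟩ : ∃ k, m = k + 1 := ⟨m - 1, by omega⟩
  rw [Finset.sum_range_succ']
  have h1 : ∑ i ∈ Finset.range k, (if k + 1 + (i + 1) ≤ k + 1 then 0 else
      2 ^ (k + 1 + (i + 1) - (k + 1) + 1)) = ∑ i ∈ Finset.range k, 2 ^ i * 4 := by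
    refine Finset.sum_congr rfl fun i hi => ?_
    rw [if_neg (by omega), Nat.add_sub_cancel_left, add_assoc, pow_add]
    rfl
  have h2 := sum_two_pow k
  rw [h1, ← Finset.sum_mul]
  simp only [add_zero, mul_zero, if_true, le_refl, Nat.zero_le, pow_succ _ (k + 1), pow_succ _ k]
  rw [if_neg (by omega)]
  omega

/-! ### The upper bound for the product -/

theorem two_mul_add_two_le_two_pow {n : ℕ} (hn : 3 ≤ n) : 2 * n + 2 ≤ 2 ^ n := by
  induction n, hn using Nat.le_induction with
  | base => norm_num
  | succ n hn ih => rw [pow_succ]; omega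

theorem two_mul_le_two_pow {n : ℕ} (hn : 2 ≤ n) : 2 * n ≤ 2 ^ n := by
  induction n, hn using Nat.le_induction with
  | base => norm_num
  | succ n hn ih => rw [pow_succ]; omega

theorem evenNumber_add_two (n : ℕ) : evenNumber n + 2 = 2 * 2 ^ n + 2 * n := by
  unfold evenNumber
  have := Nat.one_le_two_pow (n := n)
  rw [pow_succ]
  omega

/-- Here `A` and `B` stand for 2^n and 2^m, `e` and `f` for the two values of `evenNumber`, `φ`,
`p₁`, `p₂` for the total weights on the factors and `s₁`, `s₂` for those on the product. -/
theorem gated_lt_two_mul {n m A B e f s₁ s₂ p₁ p₂ φ : ℕ} (hn : 3 ≤ n) (hm : 2 ≤ m)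
    (hA : 2 * n + 2 ≤ A) (hB : 4 ≤ B) (he : e + 2 = 2 * A + 2 * n) (hf : f + 2 = 2 * B + 2 * m)
    (hφ : φ + 3 = 3 * A + 2 * n) (hp : p₁ + p₂ + 6 = 4 * B + 4 * m)
    (h₁ : s₁ + (2 * n + 2 * n) * B + A = (2 * n + 2 * n) * p₁ + φ * B + φ)
    (h₂ : s₂ + (2 * n + 2 * n) * B + A = (2 * n + 2 * n) * p₂ + φ * B + φ) :
    s₁ + s₂ < 2 * (e * f) := by
  zify at *
  have he' : (e : ℤ) = 2 * A + 2 * n - 2 := by linarith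
  have hf' : (f : ℤ) = 2 * B + 2 * m - 2 := by linarith
  have hφ' : (φ : ℤ) = 3 * A + 2 * n - 3 := by linarith
  have hp' : (p₂ : ℤ) = 4 * B + 4 * m - 6 - p₁ := by linarith
  rw [hφ'] at h₁ h₂
  rw [hp'] at h₂
  rw [he', hf']
  -- The right side minus the left equals 2(A - (2n+2))(B + 4m - 6) + 8n(m - 2) + (4n + 2B + 8m -
  -- 10), and the last bracket is positive.
  have k₁ : 0 ≤ ((A : ℤ) - (2 * n + 2)) * (B + 4 * m - 6) :=
    mul_nonneg (by linarith) (by linarith)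
  have k₂ : 0 ≤ (n : ℤ) * (m - 2) := mul_nonneg (by linarith) (by linarith)
  linarith

theorem suffices_inr_of_gated {n m : ℕ} (hn : 3 ≤ n) (hm : 2 ≤ m)
    {v g₁ g₂ : Fin (2 * m) ⊕ Fin (2 * m)} {ψ₁ ψ₂ : Fin (2 * m) ⊕ Fin (2 * m) → ℕ}
    (h₁ : IsGated (middleCycle (2 * m) (by omega)) v g₁ ψ₁)
    (h₂ : IsGated (middleCycle (2 * m) (by omega)) v g₂ ψ₂)
    (hcov : ∀ y, y ≠ v → 2 ≤ ψ₁ y + ψ₂ y) (hg₁ : ψ₁ g₁ = 2 ^ m) (hg₂ : ψ₂ g₂ = 2 ^ m)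
    (hsum : ∑ y, ψ₁ y + ∑ y, ψ₂ y + 6 = 4 * 2 ^ m + 4 * m) :
    Suffices (middleCycle (2 * n) (by omega) □ middleCycle (2 * m) (by omega))
      (.inr ⟨0, by omega⟩, v) (evenNumber n * evenNumber m) := by
  refine suffices_of_gated (isRadial_radialWeight (by omega)) h₁ h₂ hcov ?_
  have s₁ := h₁.sum_gatedWeight (u := .inr ⟨0, by omega⟩) (φ := radialWeight n)
  have s₂ := h₂.sum_gatedWeight (u := .inr ⟨0, by omega⟩) (φ := radialWeight n)
  have h0 : radialWeight n (.inr ⟨0, by omega⟩) = 2 ^ n := by simp [radialWeight]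
  rw [h0, Fintype.card_sum, Fintype.card_fin] at s₁ s₂
  rw [hg₁] at s₁
  rw [hg₂] at s₂
  exact gated_lt_two_mul hn hm (two_mul_add_two_le_two_pow hn) (four_le_two_pow hm)
    (evenNumber_add_two n) (evenNumber_add_two m) (sum_radialWeight n) hsum s₁ s₂

theorem sum_shortWeight_radialWeight {m : ℕ} {v g t : Fin (2 * m) ⊕ Fin (2 * m)}
    {ψ : Fin (2 * m) ⊕ Fin (2 * m) → ℕ} {H : SimpleGraph (Fin (2 * m) ⊕ Fin (2 * m))}
    (hψ : IsGated H v g ψ) (ht : IsFarEnd g t ψ) :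
    ∑ z, shortWeight (.inr ⟨0, by omega⟩) (radialWeight 2) v g t ψ z =
      4 * ∑ y, ψ y + 6 * ∑ y, min 2 (ψ y) + 4 * ψ g + 5 := by
  have hg2 : 2 ≤ ψ g := ht.two_le g ht.ne_gate.symm hψ.gate_pos
  rw [Fintype.sum_prod_type, Finset.sum_congr rfl fun x _ =>
    isShort_radialWeight.sum_shortWeight hψ ht x, Fintype.sum_sum_type]
  -- The eight columns split as one with `φ = 4`, two with `φ = 2` and five with `φ = 1`.
  change ∑ i : Fin 4, _ + ∑ i : Fin 4, _ = _
  simp [Fin.sum_univ_four, radialWeight]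
  omega

/-- The product bound for the target `(Sum.inr 0, Sum.inl 0)`. -/
theorem suffices_inr_inl {n m : ℕ} (hn : 2 ≤ n) (hm : 2 ≤ m) :
    Suffices (middleCycle (2 * n) (by omega) □ middleCycle (2 * m) (by omega))
      (.inr ⟨0, by omega⟩, .inl ⟨0, by omega⟩) (evenNumber n * evenNumber m) := by
  have hl := isGated_leftWeightInl hm
  have hr := isGated_rightWeightInl hm
  have sl := sum_leftWeightInl hm
  have sr := sum_rightWeightInl hm
  have gl : leftWeightInl m (.inr ⟨0, by omega⟩) = 2 ^ m := by
    simp only [leftWeightInl]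
    rw [if_pos (by omega), Nat.sub_zero]
  have gr : rightWeightInl m (.inr ⟨2 * m - 1, by omega⟩) = 2 ^ m := by
    simp only [rightWeightInl]
    rw [if_neg (by omega)]
    congr 1
    omega
  rw [pow_succ] at sl sr
  rcases hn.lt_or_eq with hn | rfl
  · exact suffices_inr_of_gated hn hm hl hr (two_le_weightInl hm) gl gr (by omega)
  · have fl := isFarEnd_leftWeightInl hm
    have fr := isFarEnd_rightWeightInl hm
    refine suffices_of_short isShort_radialWeight hl hr fl fr (two_le_weightInl hm) ?_
    rw [sum_shortWeight_radialWeight hl fl, sum_shortWeight_radialWeight hr fr,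
      sum_min_leftWeightInl hm, sum_min_rightWeightInl hm, gl, gr]
    have h2 : evenNumber 2 = 10 := rfl
    have h3 := evenNumber_add_two m
    -- The claim is 24 · 2^m + 64m - 26 < 40 · 2^m + 40m - 40, which follows from 2m ≤ 2^m and m ≥
    -- 2.
    have h4 := two_mul_le_two_pow hm
    rw [h2]
    omega

theorem suffices_inr_inr_of_three_le {n m : ℕ} (hn : 3 ≤ n) (hm : 2 ≤ m) :
    Suffices (middleCycle (2 * n) (by omega) □ middleCycle (2 * m) (by omega))
      (.inr ⟨0, by omega⟩, .inr ⟨0, by omega⟩) (evenNumber n * evenNumber m) := by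
  have sl := sum_leftWeightInr hm
  have sr := sum_rightWeightInr hm
  rw [pow_succ] at sl sr
  refine suffices_inr_of_gated hn hm (isGated_leftWeightInr hm) (isGated_rightWeightInr hm)
    (two_le_weightInr hm) ?_ ?_ (by omega)
  · simp only [leftWeightInr]
    rw [if_neg (by omega), if_pos (by omega)]
    congr 1
    omega
  · simp only [rightWeightInr]
    rw [if_neg (by omega)]
    congr 1
    omega

/-- The product bound for the target `(Sum.inr 0, Sum.inr 0)`. -/
theorem suffices_inr_inr {n m : ℕ} (hn : 2 ≤ n) (hm : 2 ≤ m) :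
    Suffices (middleCycle (2 * n) (by omega) □ middleCycle (2 * m) (by omega))
      (.inr ⟨0, by omega⟩, .inr ⟨0, by omega⟩) (evenNumber n * evenNumber m) := by
  rcases hn.lt_or_eq with hn3 | rfl
  · exact suffices_inr_inr_of_three_le hn3 hm
  rcases hm.lt_or_eq with hm3 | rfl
  · rw [mul_comm (evenNumber 2)]
    exact (suffices_inr_inr_of_three_le hm3 hn).map (boxProdComm _ _)
  · refine suffices_of_isShort isShort_radialWeight isShort_radialWeight ?_
    -- One column of total 26, two of 18 and five of 7 give 97; two copies make 194, below 2 · 10 ·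
    -- 10.
    have h : ∑ z, centralWeight (radialWeight 2) (radialWeight 2) z = 97 := by decide +kernel
    rw [h]
    decide

/-- The product bound for a new vertex in the first factor. -/
theorem suffices_middleGraph {n m : ℕ} (hn : 2 ≤ n) (hm : 2 ≤ m)
    (x : (cycleGraph (2 * n)).edgeSet) (v : Fin (2 * m) ⊕ (cycleGraph (2 * m)).edgeSet) :
    Suffices (middleGraph (cycleGraph (2 * n)) □ middleGraph (cycleGraph (2 * m))) (.inr x, v)
      (evenNumber n * evenNumber m) := by
  obtain ⟨e, he⟩ := exists_iso_inr (N := 2 * n) (by omega) x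
  rcases v with a | y
  · obtain ⟨f, hf⟩ := exists_iso_inl (N := 2 * m) (by omega) a
    rw [← he, ← hf]
    exact (suffices_inr_inl hn hm).map (boxProdIso e f)
  · obtain ⟨f, hf⟩ := exists_iso_inr (N := 2 * m) (by omega) y
    rw [← he, ← hf]
    exact (suffices_inr_inr hn hm).map (boxProdIso e f)

end Pebbling

theorem theorem3p2 (n m : ℕ) (hn : 2 ≤ n) (hm : 2 ≤ m)
    (u : Fin (2 * n) ⊕ (SimpleGraph.cycleGraph (2 * n)).edgeSet)
    (v : Fin (2 * m) ⊕ (SimpleGraph.cycleGraph (2 * m)).edgeSet)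
    (huv : (u, v) ∉ Pebbling.originalVertices (SimpleGraph.cycleGraph (2 * n)) ×ˢ
      Pebbling.originalVertices (SimpleGraph.cycleGraph (2 * m))) :
    Pebbling.pebblingNumberAt
        (Pebbling.middleGraph (SimpleGraph.cycleGraph (2 * n)) □
          Pebbling.middleGraph (SimpleGraph.cycleGraph (2 * m))) (u, v) ≤
      Pebbling.pebblingNumber (Pebbling.middleGraph (SimpleGraph.cycleGraph (2 * n))) *
        Pebbling.pebblingNumber (Pebbling.middleGraph (SimpleGraph.cycleGraph (2 * m))) := by
  -- Any sufficient number bounds the infimum from above, so connectedness of the product plays no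
  -- role.
  refine le_trans (Nat.sInf_le ?_) (Nat.mul_le_mul (Pebbling.evenNumber_le_pebblingNumber hn)
    (Pebbling.evenNumber_le_pebblingNumber hm))
  rcases u with a | x
  · rcases v with b | y
    · exact absurd ⟨⟨a, rfl⟩, ⟨b, rfl⟩⟩ huv
    -- When only `v` is new, the factors are exchanged to bring the new vertex into the first one.
    · rw [mul_comm (Pebbling.evenNumber n)]
      exact (Pebbling.suffices_middleGraph hm hn y (.inl a)).map (SimpleGraph.boxProdComm _ _)
  · exact Pebbling.suffices_middleGraph hn hm x v
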